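/- All graphs are simple and undirected, with a possibly infinite vertex set. For a graph $G=(V,E)$ let $|G|$ be its $1$-complex: the quotient space of the disjoint union of the discrete space $V$ and one copy $[0,1]_e$ of the unit interval for each edge $e=\{v,w\}$, where $0\in[0,1]_e$ is identified with $v$ and $1\in[0,1]_e$ with $w$. An arc is a space homeomorphic to $[0,1]$. The graph $G$ is $3$-ac if for any choice of at most three points of $|G|$ there is an arc in $|G|$ containing them. A graph is $2$-connected if it is connected (hence non-empty) and removing any single vertex does not disconnect it (so $K_1$ and $K_2$ are $2$-connected). A block of $G$ is an inclusion-maximal $2$-connected subgraph of $G$. A cut-vertex is a vertex $c$ whose deletion separates two other vertices lying in the same component of $G$. The block graph $B(G)$ is the bipartite graph whose vertices are the cut-vertices and the blocks of $G$, with a cut-vertex $c$ adjacent to a block $B$ if and only if $c\in B$. A connected graph $G$ is a chain graph if it is the union of a linearly ordered family (possibly with just one member) of subgraphs, called links, such that any two consecutive links have exactly one vertex in common and any two distinct non-consecutive links are disjoint. Theorem. Let $G$ be a (possibly infinite) graph with at least two vertices. The following are equivalent: 1. $G$ is $3$-ac; 2. $G$ is a chain graph all of whose links are $2$-connected; 3.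 the block graph $B(G)$ is a finite path (with at least one vertex), a ray or a double ray; 4. the block graph $B(G)$ is connected and has no vertex of degree at least $3$. -/

import Mathlib

universe u

namespace ArcGraph

/-! The topological space of a graph, arcs and `n`-arc connectedness -/

section Topology

/-- The disjoint union of the vertex set and of one unit interval for every edge. -/
def Pieces {V : Type u} (G : SimpleGraph V) : Type u :=
  V ⊕ (Σ _ : G.edgeSet, unitInterval)

/-- The vertex set is discrete and each interval has its usual topology. -/
instance {V : Type u} (G : SimpleGraph V) : TopologicalSpace (Pieces G) :=
  @instTopologicalSpaceSum V (Σ _ : G.edgeSet, unitInterval) ⊥ inferInstance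

/-- The gluing relation: the interval of the edge `e = {v, w}` is glued to `v` at `0` and to `w`
at `1`, where `(v, w) = Quot.out e` is an arbitrarily chosen enumeration of the ends of `e`. -/
inductive Glue {V : Type u} (G : SimpleGraph V) : Pieces G → Pieces G → Prop
  | zero (e : G.edgeSet) : Glue G (Sum.inr ⟨e, 0⟩) (Sum.inl (Quot.out (e : Sym2 V)).1)
  | one (e : G.edgeSet) : Glue G (Sum.inr ⟨e, 1⟩) (Sum.inl (Quot.out (e : Sym2 V)).2)

/-- The `1`-complex `|G|` of the graph `G`. -/
def Realization {V : Type u} (G : SimpleGraph V) : Type u := Quot (Glue G)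

/-- `|G|` carries the quotient topology. -/
instance {V : Type u} (G : SimpleGraph V) : TopologicalSpace (Realization G) :=
  inferInstanceAs (TopologicalSpace (Quot (Glue G)))

/-- An arc is a subspace homeomorphic to the closed unit interval. -/
def IsArc {X : Type u} [TopologicalSpace X] (A : Set X) : Prop :=
  Nonempty (A ≃ₜ unitInterval)

/-- A space is `n`-arc connected if any at most `n` of its points lie on a common arc. -/
def IsArcConnectedSpace (n : ℕ) (X : Type u) [TopologicalSpace X] : Prop :=
  ∀ S : Set X, S.encard ≤ n → ∃ A : Set X, IsArc A ∧ S ⊆ A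

/-- A graph is `n`-ac if its `1`-complex is `n`-arc connected. -/
def IsAc {V : Type u} (n : ℕ) (G : SimpleGraph V) : Prop :=
  IsArcConnectedSpace n (Realization G)

end Topology

/-! `2`-connectedness, blocks and the block graph -/

section Blocks

/-- A graph is `2`-connected if it is connected and removing any single vertex does not disconnect
it. The complete graphs on one and on two vertices are `2`-connected in this sense. -/
def IsTwoConnected {W : Type u} (H : SimpleGraph W) : Prop :=
  H.Connected ∧ ∀ v : W, (H.induce {v}ᶜ).Preconnected

/-- A block is an inclusion-maximal `2`-connected subgraph. -/
def IsBlock {V : Type u} {G : SimpleGraph V} (B : G.Subgraph) : Prop :=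
  Maximal (fun H : G.Subgraph => IsTwoConnected H.coe) B

/-- A cut-vertex is a vertex whose removal separates two other vertices that `G` connects. -/
def IsCutVertex {V : Type u} (G : SimpleGraph V) (c : V) : Prop :=
  ∃ x y : ({c}ᶜ : Set V), G.Reachable x y ∧ ¬ (G.induce {c}ᶜ).Reachable x y

/-- The block graph: the bipartite graph on the cut-vertices and the blocks of `G` in which a
cut-vertex `c` and a block `B` are adjacent if and only if `c ∈ B`. -/
def blockGraph {V : Type u} (G : SimpleGraph V) :
    SimpleGraph ({c : V // IsCutVertex G c} ⊕ {B : G.Subgraph // IsBlock B}) :=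
  SimpleGraph.fromRel fun p q => ∃ c B, p = Sum.inl c ∧ q = Sum.inr B ∧ (c : V) ∈ B.1.verts

/-- The graph is a path with finitely many, and at least one, vertices. -/
def IsFinitePath {W : Type u} (T : SimpleGraph W) : Prop :=
  ∃ n : ℕ, 1 ≤ n ∧ Nonempty (T ≃g SimpleGraph.pathGraph n)

/-- The graph is a ray (a one-way infinite path). -/
def IsRay {W : Type u} (T : SimpleGraph W) : Prop :=
  Nonempty (T ≃g SimpleGraph.hasse ℕ)

/-- The graph is a double ray (a two-way infinite path). -/
def IsDoubleRay {W : Type u} (T : SimpleGraph W) : Prop :=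
  Nonempty (T ≃g SimpleGraph.hasse ℤ)

end Blocks

/-! Chain graphs -/

section Chains

/-- `G` is the union of the linearly ordered family `L` of subgraphs (the links), any two
consecutive links have exactly one vertex in common, and no other two links meet. Here `i` and `j`
are consecutive, `i ⋖ j`, if `i < j` and there is no index strictly between them. -/
structure IsChainOfLinks {V : Type u} (G : SimpleGraph V) {ι : Type u} [LinearOrder ι]
    (L : ι → G.Subgraph) : Prop where
  iSup_eq_top : ⨆ i, L i = ⊤
  consecutive : ∀ i j, i ⋖ j → ∃ v, (L i).verts ∩ (L j).verts = {v}
  disjoint : ∀ i j, i < j → ¬ i ⋖ j → Disjoint (L i).verts (L j).verts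

/-- `G` is a chain graph of `2`-connected links. -/
def IsChainGraphOfTwoConnected {V : Type u} (G : SimpleGraph V) : Prop :=
  G.Connected ∧ ∃ (ι : Type u) (_ : LinearOrder ι) (L : ι → G.Subgraph),
    IsChainOfLinks G L ∧ ∀ i, IsTwoConnected (L i).coe

end Chains

end ArcGraph

/-! If two blocks share `v` and a path avoiding `v` joins them, then they and the path lie in one
larger 2-connected subgraph (`exists_isTwoConnected_ge`), so the blocks are equal. Hence every edge
of the block graph is a bridge (`blockGraph_isAcyclic`), and for connected `G` the block graph is a
tree. A tree without vertices of degree three can be numbered by an interval of ℤ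
(`isLinear_of_isTree`). Which ends of the interval are bounded decides between finite path, ray and
double ray, and the blocks in the order of their numbers form a chain (`isChainGraph_of_isLinear`).

Degree three in the block graph yields three vertices, each cut off from the other two by a single
vertex (`hasSeparatedTriple_of_degree`). On an arc through them one lies between the other two, and
the arc would have to pass its separating vertex on both sides of it
(`not_hasSeparatedTriple_of_isAc`). So 3-ac graphs have linear block graphs.

Conversely, in a chain of 2-connected links the given points are replaced by the cells containing
them, that is, by vertices of the subdivision. If one of three cells separates the other two, a path
between those two runs through it. Otherwise take the cell in the middle link: a vertex cannot cut
it off from both other cells, because the links on one side of the middle link avoid that vertex. A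
Menger-type fan argument (`exists_isPath_through`) then gives a path through all three, which is
turned into an arc (`exists_isArc_of_isPath`). -/

namespace ArcGraph

open SimpleGraph

/-! ### Deleting a vertex while keeping the vertex type -/

section Deletion

variable {V : Type*} {G H : SimpleGraph V} {x a b c : V}

/-- The graph `G` without the edges at `x`. -/
def del (G : SimpleGraph V) (x : V) : SimpleGraph V where
  Adj a b := G.Adj a b ∧ a ≠ x ∧ b ≠ x
  symm := ⟨fun _ _ h => ⟨h.1.symm, h.2.2, h.2.1⟩⟩
  loopless := ⟨fun _ h => h.1.ne rfl⟩

lemma del_adj : (del G x).Adj a b ↔ G.Adj a b ∧ a ≠ x ∧ b ≠ x := Iff.rfl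

lemma del_le : del G x ≤ G := fun _ _ h => h.1

lemma del_mono (h : G ≤ H) : del G x ≤ del H x := fun _ _ hab => ⟨h hab.1, hab.2⟩

/-- Reachability does not change when vertices that no edge joins to the rest are dropped. -/
lemma reachable_subtype_iff {S : Set V} (K' : SimpleGraph S) (K : SimpleGraph V)
    (hK : ∀ a b : S, K'.Adj a b ↔ K.Adj a b) (hS : ∀ a b, K.Adj a b → a ∈ S → b ∈ S) (a b : S) :
    K'.Reachable a b ↔ K.Reachable a b := by
  constructor
  · intro h
    exact h.map (⟨Subtype.val, fun {a b} h => (hK a b).1 h⟩ : K' →g K)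
  · rintro ⟨p⟩
    obtain ⟨a, ha⟩ := a
    obtain ⟨b, hb⟩ := b
    simp only at p
    induction p with
    | nil => exact Reachable.refl _
    | cons h p ih =>
      exact ((hK ⟨_, ha⟩ ⟨_, hS _ _ h ha⟩).2 h).reachable.trans (ih (hS _ _ h ha) hb)

lemma reachable_induce_compl_iff (a b : ({c}ᶜ : Set V)) :
    (G.induce {c}ᶜ).Reachable a b ↔ (del G c).Reachable a b :=
  reachable_subtype_iff _ (del G c) (fun a b => ⟨fun h => ⟨h, a.2, b.2⟩, fun h => h.1⟩)
    (fun _ _ h _ => h.2.2) a b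

lemma not_mem_support_of_walk_del (p : (del G x).Walk a b) (ha : a ≠ x) : x ∉ p.support := by
  induction p with
  | nil => simpa using ha.symm
  | cons h p ih =>
    simp only [Walk.support_cons, List.mem_cons, not_or]
    exact ⟨ha.symm, ih h.2.2⟩

lemma reachable_del_of_walk (p : G.Walk a b) (hp : ∀ e ∈ p.edges, e ∈ H.edgeSet)
    (hx : x ∉ p.support) : (del H x).Reachable a b := by
  refine ⟨p.transfer _ fun e he => ?_⟩
  induction e with
  | h c d =>
    refine ⟨hp _ he, ?_, ?_⟩
    · rintro rfl; exact hx (p.fst_mem_support_of_mem_edges he)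
    · rintro rfl; exact hx (p.snd_mem_support_of_mem_edges he)

lemma ne_of_reachable_del (h : (del G x).Reachable a b) (ha : a ≠ x) : b ≠ x := by
  obtain ⟨p⟩ := h
  rintro rfl
  exact not_mem_support_of_walk_del p ha p.end_mem_support

/-- If `c` separates `a` from `x`, then `x` does not separate `a` from `c`. -/
lemma reachable_del_of_not_reachable_del (hac : G.Reachable a c) (hne : a ≠ c) (hx : x ≠ c)
    (h : ¬ (del G c).Reachable a x) : (del G x).Reachable a c := by
  obtain ⟨p⟩ := hac
  -- Until it first meets `c`, the walk stays in the component of `a` in `G - c`, and this component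
  -- misses `x`.
  induction p with
  | nil => exact absurd rfl hne
  | @cons a a' c hadj p ih =>
    have hax : a ≠ x := by rintro rfl; exact h (Reachable.refl _)
    by_cases hc : a' = c
    · subst hc
      exact Adj.reachable (G := del G x) ⟨hadj, hax, hx.symm⟩
    · have hadj' : (del G c).Adj a a' := ⟨hadj, hne, hc⟩
      have h' : ¬ (del G c).Reachable a' x := fun h' => h (hadj'.reachable.trans h')
      have hax' : a' ≠ x := by rintro rfl; exact h' (Reachable.refl _)
      exact (Adj.reachable (G := del G x) ⟨hadj, hax, hax'⟩).trans (ih hc hx h')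

/-- On a path, every vertex other than `x` is joined to one of the ends by a part of the path that
avoids `x`. -/
lemma reachable_del_end_of_isPath (p : G.Walk a b) (hp : p.IsPath)
    (hH : ∀ e ∈ p.edges, e ∈ H.edgeSet) {y : V} (hy : y ∈ p.support) (hyx : y ≠ x) :
    (a ≠ x ∧ (del H x).Reachable y a) ∨ (b ≠ x ∧ (del H x).Reachable y b) := by
  classical
  -- A path visits `x` at most once, so `x` cannot lie on both sides of `y`.
  by_cases hx : x ∈ (p.takeUntil y hy).support
  · right
    have hx' : x ∉ (p.dropUntil y hy).support := by
      intro hx'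
      have hspec := p.take_spec hy
      rw [← hspec, Walk.isPath_def, Walk.support_append] at hp
      have hx'' : x ∈ (p.dropUntil y hy).support.tail := by
        rw [← Walk.cons_tail_support] at hx'
        exact (List.mem_cons.1 hx').resolve_left hyx.symm
      exact (List.nodup_append.1 hp).2.2 _ hx _ hx'' rfl
    refine ⟨fun h => hx' (h ▸ Walk.end_mem_support _),
      reachable_del_of_walk _ (fun e he => hH e ?_) hx'⟩
    exact p.edges_dropUntil_subset_edges hy he
  · left
    refine ⟨fun h => hx (h ▸ Walk.start_mem_support _),
      (reachable_del_of_walk _ (fun e he => hH e ?_) hx).symm⟩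
    exact p.edges_takeUntil_subset_edges hy he

end Deletion

/-! ### 2-connected subgraphs and blocks -/

section TwoConnected

variable {V : Type u} {G : SimpleGraph V}

/-- Moves everything to the ambient vertex type, where different subgraphs can be compared. The
deleted vertex may then lie outside `H`; in that case plain connectedness suffices. -/
lemma isTwoConnected_coe_iff (H : G.Subgraph) :
    IsTwoConnected H.coe ↔ H.verts.Nonempty ∧
      (∀ a ∈ H.verts, ∀ b ∈ H.verts, H.spanningCoe.Reachable a b) ∧
      ∀ x, ∀ a ∈ H.verts, ∀ b ∈ H.verts, a ≠ x → b ≠ x →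
        (del H.spanningCoe x).Reachable a b := by
  have h1 : ∀ a b : H.verts, H.coe.Reachable a b ↔ H.spanningCoe.Reachable a b :=
    reachable_subtype_iff _ _ (fun _ _ => Iff.rfl) (fun a b h _ => H.edge_vert h.symm)
  have h2 : ∀ x : H.verts, ∀ a b : H.verts,
      (del H.coe x).Reachable a b ↔ (del H.spanningCoe x).Reachable a b := fun x =>
    reachable_subtype_iff _ _ (fun a b => by
      simp only [del_adj, Subgraph.coe_adj, Subgraph.spanningCoe_adj, ne_eq, Subtype.ext_iff])
      (fun a b h _ => H.edge_vert h.1.symm)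
  unfold IsTwoConnected
  rw [connected_iff]
  constructor
  · rintro ⟨⟨hpre, hne⟩, h⟩
    have hreach : ∀ a ∈ H.verts, ∀ b ∈ H.verts, H.spanningCoe.Reachable a b :=
      fun a ha b hb => (h1 ⟨a, ha⟩ ⟨b, hb⟩).1 (hpre _ _)
    refine ⟨Set.nonempty_coe_sort.1 hne, hreach, fun x a ha b hb hax hbx => ?_⟩
    by_cases hx : x ∈ H.verts
    · have := h ⟨x, hx⟩ ⟨⟨a, ha⟩, fun h => hax (congrArg Subtype.val h)⟩
        ⟨⟨b, hb⟩, fun h => hbx (congrArg Subtype.val h)⟩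
      rw [reachable_induce_compl_iff] at this
      exact (h2 ⟨x, hx⟩ _ _).1 this
    · refine (hreach a ha b hb).mono fun c d hcd => ⟨hcd, ?_, ?_⟩
      · rintro rfl; exact hx (H.edge_vert hcd)
      · rintro rfl; exact hx (H.edge_vert hcd.symm)
  · rintro ⟨hne, hreach, h⟩
    refine ⟨⟨fun a b => (h1 a b).2 (hreach a a.2 b b.2), hne.to_subtype⟩, fun x a b => ?_⟩
    rw [reachable_induce_compl_iff, h2]
    exact h x a a.1.2 b b.1.2 (fun h => a.2 (Subtype.ext h)) (fun h => b.2 (Subtype.ext h))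

lemma IsTwoConnected.reachable_del {H : G.Subgraph} (hH : IsTwoConnected H.coe) {x a b : V}
    (ha : a ∈ H.verts) (hb : b ∈ H.verts) (hax : a ≠ x) (hbx : b ≠ x) :
    (del G x).Reachable a b :=
  (((isTwoConnected_coe_iff H).1 hH).2.2 x a ha b hb hax hbx).mono
    (del_mono H.spanningCoe_le)

lemma IsTwoConnected.reachable {H : G.Subgraph} (hH : IsTwoConnected H.coe) {a b : V}
    (ha : a ∈ H.verts) (hb : b ∈ H.verts) : G.Reachable a b :=
  (((isTwoConnected_coe_iff H).1 hH).2.1 a ha b hb).mono H.spanningCoe_le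

/-- Two `2`-connected subgraphs that share a vertex `v` and are joined by a path avoiding `v` lie in
a common `2`-connected subgraph. -/
lemma exists_isTwoConnected_ge {H K : G.Subgraph} (hH : IsTwoConnected H.coe)
    (hK : IsTwoConnected K.coe) {v b b' : V} (hvH : v ∈ H.verts) (hvK : v ∈ K.verts)
    (hb : b ∈ H.verts) (hb' : b' ∈ K.verts) (hbv : b ≠ v)
    (h : (del G v).Reachable b b') :
    ∃ M : G.Subgraph, IsTwoConnected M.coe ∧ H ≤ M ∧ K ≤ M := by
  have hbv' : b' ≠ v := ne_of_reachable_del h hbv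
  obtain ⟨q, hq⟩ := h.exists_isPath
  set p : G.Walk b b' := q.mapLe del_le with hp
  have hpath : p.IsPath := hq.mapLe _
  have hvp : v ∉ p.support := by
    rw [hp, Walk.support_mapLe_eq_support]
    exact not_mem_support_of_walk_del q hbv
  set M : G.Subgraph := H ⊔ K ⊔ p.toSubgraph with hM
  have hHM : H ≤ M := le_sup_left.trans le_sup_left
  have hKM : K ≤ M := le_sup_right.trans le_sup_left
  have hpM : ∀ e ∈ p.edges, e ∈ M.spanningCoe.edgeSet := by
    intro e he
    rw [Subgraph.edgeSet_spanningCoe]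
    exact Subgraph.edgeSet_mono (le_sup_right : p.toSubgraph ≤ M) (p.mem_edges_toSubgraph.2 he)
  obtain ⟨-, hH1, hH2⟩ := (isTwoConnected_coe_iff H).1 hH
  obtain ⟨-, hK1, hK2⟩ := (isTwoConnected_coe_iff K).1 hK
  have hHs : H.spanningCoe ≤ M.spanningCoe := Subgraph.spanningCoe_le_of_le hHM
  have hKs : K.spanningCoe ≤ M.spanningCoe := Subgraph.spanningCoe_le_of_le hKM
  have hmem : ∀ a ∈ M.verts, a ∈ H.verts ∨ a ∈ K.verts ∨ a ∈ p.support := by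
    intro a ha
    simpa [hM, or_assoc] using ha
  -- The meeting point after deleting `x` is `v` when `x ≠ v`, and `b` when `x = v`.
  have hdel : ∀ x a, a ∈ M.verts → a ≠ x → x ≠ v → (del M.spanningCoe x).Reachable a v := by
    intro x a ha hax hxv
    have hcH : ∀ a ∈ H.verts, a ≠ x → (del M.spanningCoe x).Reachable a v := fun a ha hax =>
      (hH2 x a ha v hvH hax hxv.symm).mono (del_mono hHs)
    have hcK : ∀ a ∈ K.verts, a ≠ x → (del M.spanningCoe x).Reachable a v := fun a ha hax =>
      (hK2 x a ha v hvK hax hxv.symm).mono (del_mono hKs)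
    rcases hmem a ha with ha | ha | ha
    · exact hcH a ha hax
    · exact hcK a ha hax
    · rcases reachable_del_end_of_isPath p hpath hpM ha hax with ⟨h1, h2⟩ | ⟨h1, h2⟩
      · exact h2.trans (hcH b hb h1)
      · exact h2.trans (hcK b' hb' h1)
  have hdelv : ∀ a, a ∈ M.verts → a ≠ v → (del M.spanningCoe v).Reachable a b := by
    intro a ha hav
    rcases hmem a ha with ha | ha | ha
    · exact (hH2 v a ha b hb hav hbv).mono (del_mono hHs)
    · exact ((hK2 v a ha b' hb' hav hbv').mono (del_mono hKs)).trans
        (reachable_del_of_walk p hpM hvp).symm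
    · classical
      exact (reachable_del_of_walk (p.takeUntil a ha)
        (fun e he => hpM e (p.edges_takeUntil_subset_edges ha he))
        (fun h => hvp (p.support_takeUntil_subset_support ha h))).symm
  have hreach : ∀ a ∈ M.verts, M.spanningCoe.Reachable a v := by
    intro a ha
    by_cases hav : a = v
    · subst hav; exact Reachable.refl _
    · exact ((hdelv a ha hav).mono del_le).trans ((hH1 b hb v hvH).mono hHs)
  refine ⟨M, (isTwoConnected_coe_iff M).2 ⟨⟨v, hHM.1 hvH⟩, fun a ha c hc =>
    (hreach a ha).trans (hreach c hc).symm, fun x a ha c hc hax hcx => ?_⟩, hHM, hKM⟩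
  by_cases hxv : x = v
  · subst hxv
    exact (hdelv a ha hax).trans (hdelv c hc hcx).symm
  · exact (hdel x a ha hax hxv).trans (hdel x c hc hcx hxv).symm

/-- Every `2`-connected subgraph lies in a block. -/
lemma exists_isBlock_ge {H : G.Subgraph} (hH : IsTwoConnected H.coe) :
    ∃ B : G.Subgraph, IsBlock B ∧ H ≤ B := by
  obtain ⟨B, hHB, hB⟩ := zorn_le_nonempty₀ {K : G.Subgraph | IsTwoConnected K.coe}
    (fun c hc hchain K₀ hK₀ => by
      have hle : ∀ K ∈ c, K.spanningCoe ≤ (sSup c).spanningCoe := fun K hK =>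
        Subgraph.spanningCoe_le_of_le (le_sSup hK)
      -- Being 2-connected is a condition on pairs of vertices, and any two vertices of the union of
      -- a chain already lie in one member.
      have hcommon : ∀ a ∈ (sSup c).verts, ∀ b ∈ (sSup c).verts,
          ∃ K ∈ c, a ∈ K.verts ∧ b ∈ K.verts := by
        intro a ha b hb
        simp only [Subgraph.verts_sSup, Set.mem_iUnion, exists_prop] at ha hb
        obtain ⟨K, hK, haK⟩ := ha
        obtain ⟨K', hK', hbK'⟩ := hb
        rcases hchain.total hK hK' with h | h
        · exact ⟨K', hK', h.1 haK, hbK'⟩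
        · exact ⟨K, hK, haK, h.1 hbK'⟩
      refine ⟨sSup c, (isTwoConnected_coe_iff _).2 ⟨?_, ?_, ?_⟩, fun K hK => le_sSup hK⟩
      · obtain ⟨v, hv⟩ := ((isTwoConnected_coe_iff _).1 (hc hK₀)).1
        exact ⟨v, (le_sSup hK₀ : K₀ ≤ sSup c).1 hv⟩
      · intro a ha b hb
        obtain ⟨K, hK, ha, hb⟩ := hcommon a ha b hb
        exact (((isTwoConnected_coe_iff _).1 (hc hK)).2.1 a ha b hb).mono (hle K hK)
      · intro x a ha b hb hax hbx
        obtain ⟨K, hK, ha, hb⟩ := hcommon a ha b hb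
        exact (((isTwoConnected_coe_iff _).1 (hc hK)).2.2 x a ha b hb hax hbx).mono
          (del_mono (hle K hK))) H hH
  exact ⟨B, hB, hHB⟩

lemma exists_isBlock_mem (v : V) : ∃ B : G.Subgraph, IsBlock B ∧ v ∈ B.verts := by
  have h : IsTwoConnected (G.singletonSubgraph v).coe := by
    refine (isTwoConnected_coe_iff _).2 ⟨⟨v, rfl⟩, ?_, ?_⟩
    · rintro a rfl b rfl; exact Reachable.refl _
    · rintro x a rfl b rfl - -; exact Reachable.refl _
  obtain ⟨B, hB, hle⟩ := exists_isBlock_ge h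
  exact ⟨B, hB, hle.1 rfl⟩

lemma exists_isBlock_adj {v w : V} (hvw : G.Adj v w) : ∃ B : G.Subgraph, IsBlock B ∧ B.Adj v w := by
  have h : IsTwoConnected (G.subgraphOfAdj hvw).coe := by
    have hadj : (G.subgraphOfAdj hvw).spanningCoe.Adj v w := by simp [hvw.ne]
    refine (isTwoConnected_coe_iff _).2 ⟨⟨v, by simp⟩, ?_, ?_⟩
    · rintro a (rfl | rfl) b (rfl | rfl)
      · exact Reachable.refl _
      · exact hadj.reachable
      · exact hadj.symm.reachable
      · exact Reachable.refl _
    · rintro x a (rfl | rfl) b (rfl | rfl) h1 h2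
      · exact Reachable.refl _
      · exact Adj.reachable (G := del _ x) ⟨hadj, h1, h2⟩
      · exact Adj.reachable (G := del _ x) ⟨hadj.symm, h1, h2⟩
      · exact Reachable.refl _
  obtain ⟨B, hB, hle⟩ := exists_isBlock_ge h
  exact ⟨B, hB, hle.2 (by simp)⟩

/-- By maximality both blocks equal the common 2-connected subgraph. The facts below on how blocks
meet rest on this. -/
lemma IsBlock.eq_of_reachable_del {B B' : G.Subgraph} (hB : IsBlock B) (hB' : IsBlock B')
    {v b b' : V} (hv : v ∈ B.verts) (hv' : v ∈ B'.verts) (hb : b ∈ B.verts) (hb' : b' ∈ B'.verts)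
    (hbv : b ≠ v) (h : (del G v).Reachable b b') : B = B' := by
  obtain ⟨M, hM, hBM, hBM'⟩ := exists_isTwoConnected_ge hB.1 hB'.1 hv hv' hb hb' hbv h
  rw [hB.eq_of_le hM hBM, hB'.eq_of_le hM hBM']

lemma IsBlock.exists_mem_ne {B B' : G.Subgraph} (hB : IsBlock B) (hB' : IsBlock B') (hne : B ≠ B')
    {v : V} (hv' : v ∈ B'.verts) : ∃ b ∈ B.verts, b ≠ v := by
  by_contra! h
  refine hne (hB.eq_of_le hB'.1 ⟨fun b hb => h b hb ▸ hv', fun a b hab => ?_⟩)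
  exact absurd ((h a (B.edge_vert hab)).trans (h b (B.edge_vert hab.symm)).symm) hab.ne

/-- A vertex in two blocks is a cut-vertex. -/
lemma IsBlock.isCutVertex {B B' : G.Subgraph} (hB : IsBlock B) (hB' : IsBlock B') (hne : B ≠ B')
    {v : V} (hv : v ∈ B.verts) (hv' : v ∈ B'.verts) : IsCutVertex G v := by
  obtain ⟨b, hb, hbv⟩ := hB.exists_mem_ne hB' hne hv'
  obtain ⟨b', hb', hbv'⟩ := hB'.exists_mem_ne hB hne.symm hv
  refine ⟨⟨b, hbv⟩, ⟨b', hbv'⟩, (hB.1.reachable hb hv).trans (hB'.1.reachable hv' hb'), ?_⟩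
  rw [reachable_induce_compl_iff]
  exact fun h => hne (hB.eq_of_reachable_del hB' hv hv' hb hb' hbv h)

lemma IsBlock.subsingleton_inter {B B' : G.Subgraph} (hB : IsBlock B) (hB' : IsBlock B')
    (hne : B ≠ B') {v w : V} (hv : v ∈ B.verts) (hv' : v ∈ B'.verts) (hw : w ∈ B.verts)
    (hw' : w ∈ B'.verts) : w = v := by
  by_contra h
  exact hne (hB.eq_of_reachable_del hB' hv hv' hw hw' h (Reachable.refl _))

end TwoConnected

end ArcGraph

namespace ArcGraph

open SimpleGraph

/-- A walk that ends in `c` enters `c` for the first time from a neighbour of `c`. -/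
lemma exists_adj_reachable_del {V : Type*} {G : SimpleGraph V} {a c : V} (h : G.Reachable a c)
    (hne : a ≠ c) : ∃ y, G.Adj y c ∧ (del G c).Reachable a y := by
  obtain ⟨p⟩ := h
  induction p with
  | nil => exact absurd rfl hne
  | @cons a a' c hadj p ih =>
    by_cases hc : a' = c
    · subst hc
      exact ⟨a, hadj, Reachable.refl _⟩
    · obtain ⟨y, hy, hay⟩ := ih hc
      exact ⟨y, hy, (Adj.reachable (G := del G c) ⟨hadj, hne, hc⟩).trans hay⟩

/-! ### The block graph is a tree; large degrees give separated triples -/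

section BlockGraph

variable {V : Type u} {G : SimpleGraph V}

lemma blockGraph_adj_inl_inr {c : {c : V // IsCutVertex G c}} {B : {B : G.Subgraph // IsBlock B}} :
    (blockGraph G).Adj (Sum.inl c) (Sum.inr B) ↔ (c : V) ∈ B.1.verts := by
  simp [blockGraph]

lemma blockGraph_adj_inr_inl {c : {c : V // IsCutVertex G c}} {B : {B : G.Subgraph // IsBlock B}} :
    (blockGraph G).Adj (Sum.inr B) (Sum.inl c) ↔ (c : V) ∈ B.1.verts := by
  rw [adj_comm, blockGraph_adj_inl_inr]

lemma not_blockGraph_adj_inl_inl {c d : {c : V // IsCutVertex G c}} :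
    ¬ (blockGraph G).Adj (Sum.inl c) (Sum.inl d) := by
  simp [blockGraph]

lemma not_blockGraph_adj_inr_inr {B C : {B : G.Subgraph // IsBlock B}} :
    ¬ (blockGraph G).Adj (Sum.inr B) (Sum.inr C) := by
  simp [blockGraph]

/-- The vertices of `G` that a vertex of the block graph stands for. -/
def nodeVerts : {c : V // IsCutVertex G c} ⊕ {B : G.Subgraph // IsBlock B} → Set V
  | Sum.inl c => {c.1}
  | Sum.inr B => B.1.verts

/-- A walk in the block graph is traced in the original graph by crossing each block from one
cut-vertex to the next. With `P` trivial this transfers connectedness; with `P` meaning "different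
from `c`" and `H` the graph without the edges at `c` it transfers avoidance of `c`. -/
lemma reachable_of_blockGraph_reachable
    {T : SimpleGraph ({c : V // IsCutVertex G c} ⊕ {B : G.Subgraph // IsBlock B})}
    (hT : T ≤ blockGraph G) {P : V → Prop} (hP : ∀ d B, T.Adj (Sum.inr B) (Sum.inl d) → P d)
    {H : SimpleGraph V} (hH : ∀ B : G.Subgraph, IsBlock B → ∀ a ∈ B.verts, ∀ b ∈ B.verts,
      P a → P b → H.Reachable a b) {n m} (h : T.Reachable n m) {a b : V} (ha : a ∈ nodeVerts n)
    (hb : b ∈ nodeVerts m) (hPa : P a) (hPb : P b) : H.Reachable a b := by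
  obtain ⟨p⟩ := h
  induction p generalizing a with
  | @nil n =>
    rcases n with d | B
    · obtain rfl : a = d := ha
      obtain rfl : b = d := hb
      exact Reachable.refl _
    · exact hH B.1 B.2 a ha b hb hPa hPb
  | @cons n n' m hadj p ih =>
    rcases n with d | B <;> rcases n' with d' | B'
    · exact absurd (hT hadj) not_blockGraph_adj_inl_inl
    · obtain rfl : a = d := ha
      exact ih (blockGraph_adj_inl_inr.1 (hT hadj)) hb hPa
    · have hd := blockGraph_adj_inr_inl.1 (hT hadj)
      have hPd := hP _ _ hadj
      exact (hH B.1 B.2 a ha d' hd hPa hPd).trans (ih rfl hb hPd)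
    · exact absurd (hT hadj) not_blockGraph_adj_inr_inr

/-- Blocks that meet are joined in the block graph. -/
lemma blockGraph_reachable_of_mem {B B' : {B : G.Subgraph // IsBlock B}} {v : V}
    (hv : v ∈ B.1.verts) (hv' : v ∈ B'.1.verts) :
    (blockGraph G).Reachable (Sum.inr B) (Sum.inr B') := by
  by_cases hne : B = B'
  · subst hne; exact Reachable.refl _
  · have hc := B.2.isCutVertex B'.2 (fun h => hne (Subtype.ext h)) hv hv'
    exact (blockGraph_adj_inr_inl (c := ⟨v, hc⟩).2 hv).reachable.trans
      (blockGraph_adj_inl_inr (c := ⟨v, hc⟩).2 hv').reachable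

lemma blockGraph_connected (hG : G.Connected) : (blockGraph G).Connected := by
  have hblock : ∀ a b : V, ∀ A B : {B : G.Subgraph // IsBlock B}, a ∈ A.1.verts → b ∈ B.1.verts →
      (blockGraph G).Reachable (Sum.inr A) (Sum.inr B) := by
    intro a b A B ha hb
    obtain ⟨p⟩ := hG.preconnected a b
    induction p generalizing A with
    | nil => exact blockGraph_reachable_of_mem ha hb
    | cons hadj p ih =>
      obtain ⟨C, hC, hCadj⟩ := exists_isBlock_adj hadj
      exact (blockGraph_reachable_of_mem (B' := ⟨C, hC⟩) ha (C.edge_vert hCadj)).trans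
        (ih ⟨C, hC⟩ (C.edge_vert hCadj.symm) hb)
  have hnode : ∀ n, ∃ v, ∃ B : {B : G.Subgraph // IsBlock B}, v ∈ B.1.verts ∧
      (blockGraph G).Reachable n (Sum.inr B) := by
    rintro (c | B)
    · obtain ⟨B, hB, hc⟩ := exists_isBlock_mem (G := G) c.1
      exact ⟨c, ⟨B, hB⟩, hc, (blockGraph_adj_inl_inr.2 hc).reachable⟩
    · obtain ⟨v, hv⟩ := ((isTwoConnected_coe_iff _).1 B.2.1).1
      exact ⟨v, B, hv, Reachable.refl _⟩
  obtain ⟨v⟩ := hG.nonempty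
  obtain ⟨B, hB, -⟩ := exists_isBlock_mem (G := G) v
  have : Nonempty ({c : V // IsCutVertex G c} ⊕ {B : G.Subgraph // IsBlock B}) :=
    ⟨Sum.inr ⟨B, hB⟩⟩
  refine ⟨fun n m => ?_⟩
  obtain ⟨a, A, ha, hA⟩ := hnode n
  obtain ⟨b, B, hb, hB⟩ := hnode m
  exact hA.trans ((hblock a b A B ha hb).trans hB.symm)

lemma connected_of_blockGraph_connected [Nonempty V] (h : (blockGraph G).Connected) :
    G.Connected := by
  refine ⟨fun a b => ?_⟩
  obtain ⟨A, hA, ha⟩ := exists_isBlock_mem (G := G) a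
  obtain ⟨B, hB, hb⟩ := exists_isBlock_mem (G := G) b
  exact reachable_of_blockGraph_reachable (P := fun _ => True) le_rfl (fun _ _ _ => trivial)
    (fun B hB a ha b hb _ _ => hB.1.reachable ha hb)
    (h.preconnected (Sum.inr ⟨A, hA⟩) (Sum.inr ⟨B, hB⟩)) ha hb trivial trivial

/-- Every edge is a bridge: if `B` reached its cut-vertex `c` without the edge between them, the
last block `B'` before `c` would contain `c` and be joined to `B` avoiding `c`, which forces `B =
B'`. -/
lemma blockGraph_isAcyclic : (blockGraph G).IsAcyclic := by
  have key : ∀ (c : {c : V // IsCutVertex G c}) (B : {B : G.Subgraph // IsBlock B}),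
      (c : V) ∈ B.1.verts → (blockGraph G).IsBridge s(Sum.inr B, Sum.inl c) := by
    intro c B hcB
    rw [isBridge_iff]
    intro h
    obtain ⟨y, hy, hBy⟩ := exists_adj_reachable_del h (by simp)
    have hy' := (deleteEdges_le _ : _ ≤ blockGraph G) hy
    rcases y with d | B'
    · exact not_blockGraph_adj_inl_inl hy'
    have hne : B ≠ B' := by
      rintro rfl
      simp [deleteEdges_adj] at hy
    have hne' : B.1 ≠ B'.1 := fun h => hne (Subtype.ext h)
    have hcB' := blockGraph_adj_inr_inl.1 hy'
    obtain ⟨b, hb, hbc⟩ := B.2.exists_mem_ne B'.2 hne' hcB'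
    obtain ⟨b', hb', hbc'⟩ := B'.2.exists_mem_ne B.2 hne'.symm hcB
    refine hne' (B.2.eq_of_reachable_del B'.2 hcB hcB' hb hb' hbc ?_)
    refine reachable_of_blockGraph_reachable (P := fun a : V => a ≠ c.1)
      (del_le.trans (deleteEdges_le _))
      (fun d B h hd => h.2.2 (congrArg Sum.inl (Subtype.ext hd))) ?_ hBy hb hb' hbc hbc'
    exact fun B hB a ha b hb => hB.1.reachable_del ha hb
  rw [isAcyclic_iff_forall_adj_isBridge]
  rintro (c | B) (d | B') h
  · exact absurd h not_blockGraph_adj_inl_inl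
  · rw [Sym2.eq_swap]
    exact key _ _ (blockGraph_adj_inl_inr.1 h)
  · exact key _ _ (blockGraph_adj_inr_inl.1 h)
  · exact absurd h not_blockGraph_adj_inr_inr

/-- Three vertices, each of them separated from the other two by a vertex. -/
def HasSeparatedTriple (G : SimpleGraph V) : Prop :=
  ∃ v c : Fin 3 → V, (∀ i j, v j ≠ c i) ∧ ∀ i j, i ≠ j → ¬ (del G (c i)).Reachable (v i) (v j)

/-- Behind every cut-vertex `c` of a block `B` there is a vertex that `c` separates from `B`. -/
lemma IsCutVertex.exists_not_reachable_del {c : V} (hc : IsCutVertex G c) {B : G.Subgraph}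
    (hB : IsBlock B) : ∃ v, v ≠ c ∧ ∀ b ∈ B.verts, b ≠ c → ¬ (del G c).Reachable v b := by
  obtain ⟨x, y, -, hxy⟩ := hc
  rw [reachable_induce_compl_iff] at hxy
  by_contra! h
  obtain ⟨b, hb, hbc, hxb⟩ := h x x.2
  obtain ⟨b', hb', hbc', hyb⟩ := h y y.2
  exact hxy (hxb.trans ((hB.1.reachable_del hb hb' hbc hbc').trans hyb.symm))

/-- Three blocks at a cut-vertex `c`: pick a vertex other than `c` in each; `c` separates all of
them. Three cut-vertices `c i` of a block: pick `v i` behind `c i`. Then `c i` separates `v i` from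
`c j`, but does not separate `c j` from `v j`. -/
lemma hasSeparatedTriple_of_degree (hG : G.Connected) (n)
    (hn : 3 ≤ ((blockGraph G).neighborSet n).encard) :
    HasSeparatedTriple G := by
  obtain ⟨t, ht, ht3⟩ := Set.exists_subset_encard_eq hn
  obtain ⟨x, y, z, hxy, hxz, hyz, rfl⟩ := Set.encard_eq_three.1 ht3
  obtain ⟨f, hf, hadj⟩ : ∃ f : Fin 3 → _, Function.Injective f ∧ ∀ i, (blockGraph G).Adj n (f i) := by
    refine ⟨![x, y, z], ?_, ?_⟩
    · intro i j h
      fin_cases i <;> fin_cases j <;> simp_all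
    · intro i
      fin_cases i
      · exact ht (by simp)
      · exact ht (by simp)
      · exact ht (by simp)
  rcases n with c | B
  · have hB : ∀ i, ∃ B : {B : G.Subgraph // IsBlock B}, f i = Sum.inr B ∧ (c : V) ∈ B.1.verts := by
      intro i
      have h := hadj i
      rcases hi : f i with d | B
      · rw [hi] at h; exact absurd h not_blockGraph_adj_inl_inl
      · rw [hi] at h; exact ⟨B, rfl, blockGraph_adj_inl_inr.1 h⟩
    choose B hfB hcB using hB
    have hne : ∀ i j, i ≠ j → (B i).1 ≠ (B j).1 := fun i j hij h =>
      hij (hf (by rw [hfB, hfB, Subtype.ext h]))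
    have hv : ∀ i, ∃ v ∈ (B i).1.verts, v ≠ c := by
      intro i
      obtain ⟨j, hj⟩ := exists_ne i
      exact (B i).2.exists_mem_ne (B j).2 (hne i j hj.symm) (hcB j)
    choose v hvB hvc using hv
    exact ⟨v, fun _ => c, fun i j => hvc j, fun i j hij h => hne i j hij
      ((B i).2.eq_of_reachable_del (B j).2 (hcB i) (hcB j) (hvB i) (hvB j) (hvc i) h)⟩
  · have hc : ∀ i, ∃ c : {c : V // IsCutVertex G c}, f i = Sum.inl c ∧ (c : V) ∈ B.1.verts := by
      intro i
      have h := hadj i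
      rcases hi : f i with d | B
      · rw [hi] at h; exact ⟨d, rfl, blockGraph_adj_inr_inl.1 h⟩
      · rw [hi] at h; exact absurd h not_blockGraph_adj_inr_inr
    choose c hfc hcB using hc
    have hne : ∀ i j, i ≠ j → (c i : V) ≠ c j := fun i j hij h =>
      hij (hf (by rw [hfc, hfc, Subtype.ext h]))
    choose v hvc hv using fun i => (c i).2.exists_not_reachable_del B.2
    have hreach : ∀ i j, i ≠ j → (del G (c i)).Reachable (v j) (c j) := fun i j hij =>
      reachable_del_of_not_reachable_del (hG.preconnected _ _) (hvc j) (hne i j hij)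
        (hv j _ (hcB i) (hne i j hij))
    refine ⟨v, fun i => c i, fun i j => ?_, fun i j hij h => ?_⟩
    · rcases eq_or_ne i j with rfl | hij
      · exact hvc i
      · intro h
        exact hv j _ (hcB i) (hne i j hij) (h ▸ Reachable.refl _)
    · exact hv i _ (hcB j) (hne i j hij).symm (h.trans (hreach i j hij))

end BlockGraph

end ArcGraph

namespace ArcGraph

open SimpleGraph

/-! ### Trees of maximum degree two are numbered by intervals of ℤ -/

section Linear

variable {W : Type*} {T : SimpleGraph W}

/-- A connected graph whose vertices are numbered by integers in such a way that exactly the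
vertices with consecutive numbers are adjacent. -/
def IsLinear (T : SimpleGraph W) : Prop :=
  T.Connected ∧ ∃ f : W → ℤ, Function.Injective f ∧
    ∀ x y, T.Adj x y ↔ f x = f y + 1 ∨ f y = f x + 1

/-- Along a tree whose vertices have degree at most two, a numbering that goes down to the root
`r` from both sides is injective. -/
lemma injective_of_descending {f : W → ℤ} {r : W} (hdeg : ∀ p, ¬ 3 ≤ (T.neighborSet p).encard)
    (h0 : ∀ x, f x = 0 → x = r)
    (hpos : ∀ x, 0 < f x → ∃ y, T.Adj x y ∧ f y = f x - 1)
    (hneg : ∀ x, f x < 0 → ∃ y, T.Adj x y ∧ f y = f x + 1)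
    (hr : ∀ x y, T.Adj r x → T.Adj r y → f x = 1 → f y = 1 → x = y)
    (ha : ∃ a, T.Adj r a ∧ f a = 1) : Function.Injective f := by
  have three : ∀ p x y z, T.Adj p x → T.Adj p y → T.Adj p z → x ≠ y → x ≠ z → y ≠ z → False := by
    intro p x y z hx hy hz hxy hxz hyz
    refine hdeg p ?_
    rw [← Set.encard_eq_three.2 ⟨x, y, z, hxy, hxz, hyz, rfl⟩]
    refine Set.encard_le_encard ?_
    rintro w (rfl | rfl | rfl) <;> assumption
  -- Induction on the distance from the root. Vertices `x ≠ y` with equal numbers have, by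
  -- induction, the same next vertex `x'` towards `r`. If `x' ≠ r`, its own next vertex is a third
  -- neighbour. If `x' = r`, the third neighbour on the negative side is `a`, while the positive
  -- side is covered by `hr`.
  have key : ∀ n : ℕ, ∀ x y, f x = f y → (f x).natAbs = n → x = y := by
    intro n
    induction n with
    | zero =>
      intro x y hxy hx
      rw [h0 x (by omega), h0 y (by omega)]
    | succ n ih =>
      intro x y hxy hx
      by_contra hne
      rcases lt_or_gt_of_ne (show f x ≠ 0 by omega) with hlt | hlt
      · obtain ⟨x', hx', hfx'⟩ := hneg x hlt
        obtain ⟨y', hy', hfy'⟩ := hneg y (by omega)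
        obtain rfl := ih x' y' (by omega) (by omega)
        by_cases hz : f x' = 0
        · obtain rfl := h0 _ hz
          obtain ⟨z, hz, hfz⟩ := ha
          refine three x' x y z hx'.symm hy'.symm hz hne ?_ ?_ <;>
            (rintro rfl; omega)
        · obtain ⟨z, hz, hfz⟩ := hneg x' (by omega)
          refine three x' x y z hx'.symm hy'.symm hz hne ?_ ?_ <;>
            (rintro rfl; omega)
      · obtain ⟨x', hx', hfx'⟩ := hpos x hlt
        obtain ⟨y', hy', hfy'⟩ := hpos y (by omega)
        obtain rfl := ih x' y' (by omega) (by omega)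
        by_cases hz : f x' = 0
        · obtain rfl := h0 _ hz
          exact hne (hr x y hx'.symm hy'.symm (by omega) (by omega))
        · obtain ⟨z, hz, hfz⟩ := hpos x' (by omega)
          refine three x' x y z hx'.symm hy'.symm hz hne ?_ ?_ <;>
            (rintro rfl; omega)
  exact fun x y hxy => key _ x y hxy rfl

/-- Removing an edge `ra` splits the tree. The number of a vertex is its distance from `r`, counted
positively on the side of `a` and negatively on the side of `r`. Adjacent vertices of a tree have
distances from `r` that differ by one, and the degree bound makes the numbering injective. -/
lemma isLinear_of_isTree (hT : T.IsTree) (hdeg : ∀ p, ¬ 3 ≤ (T.neighborSet p).encard) :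
    IsLinear T := by
  classical
  refine ⟨hT.connected, ?_⟩
  rcases subsingleton_or_nontrivial W with hW | hW
  · refine ⟨fun _ => 0, fun x y _ => Subsingleton.elim x y, fun x y => ?_⟩
    simp [Subsingleton.elim x y]
  obtain ⟨r⟩ := hT.connected.nonempty
  obtain ⟨a, hra⟩ := hT.connected.preconnected.exists_adj_of_nontrivial r
  have hbridge : ¬ (T.deleteEdges {s(r, a)}).Reachable r a :=
    isBridge_iff.1 (isAcyclic_iff_forall_adj_isBridge.1 hT.isAcyclic hra)
  set A : Set W := {x | (T.deleteEdges {s(r, a)}).Reachable a x} with hA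
  have hrA : r ∉ A := fun h => hbridge (Reachable.symm h)
  have haA : a ∈ A := Reachable.refl _
  have hcross : ∀ x y, T.Adj x y → x ∈ A → y ∉ A → x = a ∧ y = r := by
    intro x y hxy hx hy
    by_cases he : s(x, y) = s(r, a)
    · rcases Sym2.eq_iff.1 he with ⟨rfl, rfl⟩ | ⟨rfl, rfl⟩
      · exact absurd hx hrA
      · exact ⟨rfl, rfl⟩
    · exact absurd (Reachable.trans hx (Adj.reachable (deleteEdges_adj.2 ⟨hxy, he⟩))) hy
  set f : W → ℤ := fun x => if x ∈ A then (T.dist r x : ℤ) else -(T.dist r x : ℤ) with hf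
  have hfA : ∀ x ∈ A, f x = T.dist r x := fun x hx => if_pos hx
  have hfA' : ∀ x ∉ A, f x = -(T.dist r x : ℤ) := fun x hx => if_neg hx
  have hfr : f r = 0 := by simp [hfA' r hrA]
  have hd0 : ∀ x, T.dist r x = 0 → x = r := fun x hx => (hT.connected.dist_eq_zero_iff.1 hx).symm
  have hda : T.dist r a = 1 := dist_eq_one_iff_adj.2 hra
  have hfa : f a = 1 := by rw [hfA a haA, hda]; rfl
  have hstep : ∀ x y, T.Adj x y → f x = f y + 1 ∨ f y = f x + 1 := by
    intro x y hxy
    have hd := hT.dist_eq_dist_add_one_of_adj r hxy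
    by_cases hx : x ∈ A <;> by_cases hy : y ∈ A
    · rw [hfA x hx, hfA y hy]; omega
    · obtain ⟨rfl, rfl⟩ := hcross x y hxy hx hy
      left; omega
    · obtain ⟨rfl, rfl⟩ := hcross y x hxy.symm hy hx
      right; omega
    · rw [hfA' x hx, hfA' y hy]; omega
  have hdesc : ∀ x, x ≠ r → ∃ y, T.Adj x y ∧ T.dist r x = T.dist r y + 1 := by
    intro x hx
    obtain ⟨p, hp⟩ := hT.connected.exists_walk_length_eq_dist x r
    cases p with
    | nil => exact absurd rfl hx
    | @cons _ y _ hxy q =>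
      refine ⟨y, hxy, ?_⟩
      have h1 := dist_le q
      have h2 := hT.dist_eq_dist_add_one_of_adj r hxy
      rw [dist_comm] at hp h1
      simp only [Walk.length_cons] at hp
      omega
  have hpos : ∀ x, 0 < f x → ∃ y, T.Adj x y ∧ f y = f x - 1 := by
    intro x hx
    have hxA : x ∈ A := by
      by_contra h
      rw [hfA' x h] at hx
      omega
    obtain ⟨y, hxy, hd⟩ := hdesc x (by rintro rfl; exact hrA hxA)
    refine ⟨y, hxy, ?_⟩
    by_cases hy : y ∈ A
    · rw [hfA x hxA, hfA y hy]; omega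
    · obtain ⟨rfl, rfl⟩ := hcross x y hxy hxA hy
      omega
  have hneg : ∀ x, f x < 0 → ∃ y, T.Adj x y ∧ f y = f x + 1 := by
    intro x hx
    have hxA : x ∉ A := by
      intro h
      rw [hfA x h] at hx
      omega
    have hxr : x ≠ r := by rintro rfl; omega
    obtain ⟨y, hxy, hd⟩ := hdesc x hxr
    refine ⟨y, hxy, ?_⟩
    by_cases hy : y ∈ A
    · exact absurd (hcross y x hxy.symm hy hxA).2 hxr
    · rw [hfA' x hxA, hfA' y hy]; omega
  have hinj : Function.Injective f := by
    refine injective_of_descending hdeg (r := r) ?_ hpos hneg ?_ ⟨a, hra, hfa⟩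
    · intro x hx
      refine hd0 x ?_
      by_cases hxA : x ∈ A
      · rw [hfA x hxA] at hx; omega
      · rw [hfA' x hxA] at hx; omega
    · have huniq : ∀ x, T.Adj r x → f x = 1 → x = a := by
        intro x hrx hx
        have hxA : x ∈ A := by
          by_contra h
          rw [hfA' x h] at hx
          omega
        exact (hcross x r hrx.symm hxA hrA).1
      intro x y hx hy hfx hfy
      rw [huniq x hx hfx, huniq y hy hfy]
  -- The vertex farther from `r` has a neighbour with the other number; by injectivity it is the
  -- other vertex.
  have hup : ∀ x y, f x = f y + 1 → T.Adj x y := by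
    intro x y hxy
    by_cases hx : 0 < f x
    · obtain ⟨z, hz, hfz⟩ := hpos x hx
      obtain rfl : z = y := hinj (by omega)
      exact hz
    · obtain ⟨z, hz, hfz⟩ := hneg y (by omega)
      obtain rfl : z = x := hinj (by omega)
      exact hz.symm
  exact ⟨f, hinj, fun x y => ⟨hstep x y, fun h => h.elim (hup x y) fun h => (hup y x h).symm⟩⟩

/-- The numbering of a linear graph takes all intermediate values. -/
lemma exists_eq_of_connected (hT : T.Connected) {f : W → ℤ}
    (hf : ∀ x y, T.Adj x y → f x = f y + 1 ∨ f y = f x + 1) {x y : W} {k : ℤ} (hx : f x ≤ k)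
    (hy : k ≤ f y) : ∃ z, f z = k := by
  obtain ⟨p⟩ := hT.preconnected x y
  induction p with
  | @nil x => exact ⟨x, le_antisymm hx hy⟩
  | @cons x x' y h p ih =>
    rcases hx.eq_or_lt with rfl | hlt
    · exact ⟨x, rfl⟩
    · exact ih (by have := hf x x' h; omega) hy

lemma nonempty_iso_of_bijective {α : Type*} {S : SimpleGraph α} (φ : W → α)
    (hinj : ∀ x y, φ x = φ y → x = y) (hsurj : ∀ k, ∃ x, φ x = k)
    (h : ∀ x y, S.Adj (φ x) (φ y) ↔ T.Adj x y) : Nonempty (T ≃g S) :=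
  ⟨⟨Equiv.ofBijective φ ⟨fun x y => hinj x y, hsurj⟩, fun {x y} => h x y⟩⟩

/-- The numbers in use form an interval of ℤ. The four cases are whether it has a least and whether
it has a greatest element; an interval with only a greatest element is reversed to give a ray. -/
lemma isFinitePath_or_of_isLinear (h : IsLinear T) :
    IsFinitePath T ∨ IsRay T ∨ IsDoubleRay T := by
  obtain ⟨hT, f, hinj, hadj⟩ := h
  have hsurj : ∀ {x y k}, f x ≤ k → k ≤ f y → ∃ z, f z = k :=
    exists_eq_of_connected hT fun x y => (hadj x y).1
  obtain ⟨r⟩ := hT.nonempty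
  by_cases hbelow : ∃ m, ∀ x, f m ≤ f x <;> by_cases habove : ∃ M, ∀ x, f x ≤ f M
  · obtain ⟨m, hm⟩ := hbelow
    obtain ⟨M, hM⟩ := habove
    left
    have hlt : ∀ x, (f x - f m).toNat < (f M - f m).toNat + 1 := fun x => by
      have := hm x; have := hM x; omega
    refine ⟨(f M - f m).toNat + 1, by omega,
      nonempty_iso_of_bijective (fun x => ⟨(f x - f m).toNat, hlt x⟩) ?_ ?_ ?_⟩
    · intro x y hxy
      have hxy := congrArg Fin.val hxy
      simp only at hxy
      have := hm x; have := hm y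
      exact hinj (by omega)
    · intro k
      obtain ⟨z, hz⟩ := hsurj (x := m) (y := M) (k := f m + k) (by omega) (by have := hm M; omega)
      exact ⟨z, Fin.ext (by simp only; omega)⟩
    · intro x y
      rw [hadj, pathGraph_adj]
      have := hm x; have := hm y
      simp only
      omega
  · obtain ⟨m, hm⟩ := hbelow
    push Not at habove
    right; left
    have hunb : ∀ n : ℕ, ∃ x, f m + n ≤ f x := by
      intro n
      induction n with
      | zero => exact ⟨m, by simp⟩
      | succ n ih =>
        obtain ⟨x, hx⟩ := ih
        obtain ⟨y, hy⟩ := habove x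
        exact ⟨y, by omega⟩
    refine nonempty_iso_of_bijective (fun x => (f x - f m).toNat) ?_ ?_ ?_
    · intro x y hxy
      have := hm x; have := hm y
      exact hinj (by omega)
    · intro k
      obtain ⟨x, hx⟩ := hunb k
      obtain ⟨z, hz⟩ := hsurj (x := m) (y := x) (k := f m + k) (by omega) hx
      exact ⟨z, by omega⟩
    · intro x y
      rw [hadj, hasse_adj, Order.covBy_iff_add_one_eq, Order.covBy_iff_add_one_eq]
      have := hm x; have := hm y
      omega
  · obtain ⟨M, hM⟩ := habove
    push Not at hbelow
    right; left
    have hunb : ∀ n : ℕ, ∃ x, f x ≤ f M - n := by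
      intro n
      induction n with
      | zero => exact ⟨M, by simp⟩
      | succ n ih =>
        obtain ⟨x, hx⟩ := ih
        obtain ⟨y, hy⟩ := hbelow x
        exact ⟨y, by omega⟩
    refine nonempty_iso_of_bijective (fun x => (f M - f x).toNat) ?_ ?_ ?_
    · intro x y hxy
      have := hM x; have := hM y
      exact hinj (by omega)
    · intro k
      obtain ⟨x, hx⟩ := hunb k
      obtain ⟨z, hz⟩ := hsurj (x := x) (y := M) (k := f M - k) hx (by omega)
      exact ⟨z, by omega⟩
    · intro x y
      rw [hadj, hasse_adj, Order.covBy_iff_add_one_eq, Order.covBy_iff_add_one_eq]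
      have := hM x; have := hM y
      omega
  · push Not at hbelow habove
    right; right
    have hunb : ∀ n : ℕ, (∃ x, f x ≤ -(n : ℤ)) ∧ ∃ x, (n : ℤ) ≤ f x := by
      intro n
      have hdown : ∀ n : ℕ, ∃ x, f x ≤ f r - n := by
        intro n
        induction n with
        | zero => exact ⟨r, by simp⟩
        | succ n ih =>
          obtain ⟨x, hx⟩ := ih
          obtain ⟨y, hy⟩ := hbelow x
          exact ⟨y, by omega⟩
      have hup : ∀ n : ℕ, ∃ x, f r + n ≤ f x := by
        intro n
        induction n with
        | zero => exact ⟨r, by simp⟩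
        | succ n ih =>
          obtain ⟨x, hx⟩ := ih
          obtain ⟨y, hy⟩ := habove x
          exact ⟨y, by omega⟩
      obtain ⟨x, hx⟩ := hdown (n + (f r).natAbs)
      obtain ⟨y, hy⟩ := hup (n + (f r).natAbs)
      exact ⟨⟨x, by omega⟩, ⟨y, by omega⟩⟩
    refine nonempty_iso_of_bijective f hinj (fun k => ?_) ?_
    · obtain ⟨⟨x, hx⟩, ⟨y, hy⟩⟩ := hunb k.natAbs
      exact hsurj (x := x) (y := y) (by omega) (by omega)
    · intro x y
      rw [hadj, hasse_adj, Order.covBy_iff_add_one_eq, Order.covBy_iff_add_one_eq]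
      omega

lemma isLinear_of_isFinitePath_or (h : IsFinitePath T ∨ IsRay T ∨ IsDoubleRay T) :
    IsLinear T := by
  rcases h with ⟨n, hn, ⟨e⟩⟩ | ⟨⟨e⟩⟩ | ⟨⟨e⟩⟩
  · obtain ⟨n, rfl⟩ := Nat.exists_eq_add_of_le' hn
    refine ⟨e.connected_iff.2 (pathGraph_connected n), fun x => ((e x : ℕ) : ℤ), fun x y h => ?_,
      fun x y => ?_⟩
    · exact e.injective (Fin.ext (Int.ofNat_inj.1 h))
    · rw [← e.map_adj_iff, pathGraph_adj]
      simp only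
      omega
  · refine ⟨e.connected_iff.2 ⟨hasse_preconnected_of_succ ℕ⟩, fun x => ((e x : ℕ) : ℤ),
      fun x y h => ?_, fun x y => ?_⟩
    · exact e.injective (Int.ofNat_inj.1 h)
    · rw [← e.map_adj_iff, hasse_adj, Order.covBy_iff_add_one_eq, Order.covBy_iff_add_one_eq]
      simp only
      omega
  · refine ⟨e.connected_iff.2 ⟨hasse_preconnected_of_succ ℤ⟩, e, e.injective, fun x y => ?_⟩
    rw [← e.map_adj_iff, hasse_adj, Order.covBy_iff_add_one_eq, Order.covBy_iff_add_one_eq]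
    omega

end Linear

/-! ### From a linear block graph to a chain of blocks -/

section Chain

variable {V : Type u} {G : SimpleGraph V}

/-- The blocks of `G`, as a type that does not carry the inclusion order. -/
def BlockIndex (G : SimpleGraph V) : Type u := {B : G.Subgraph // IsBlock B}

/-- If the block graph is linear, then the blocks form a chain. -/
lemma isChainGraph_of_isLinear [Nonempty V] (h : IsLinear (blockGraph G)) :
    IsChainGraphOfTwoConnected G := by
  obtain ⟨hconn, f, hinj, hadj⟩ := h
  refine ⟨connected_of_blockGraph_connected hconn, BlockIndex G,
    LinearOrder.lift' (fun B => f (Sum.inr B)) (hinj.comp Sum.inr_injective), fun B => B.1, ?_,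
    fun B => B.2.1⟩
  let _ : LinearOrder (BlockIndex G) :=
    LinearOrder.lift' (fun B => f (Sum.inr B)) (hinj.comp Sum.inr_injective)
  have hlt : ∀ B C : BlockIndex G, B < C ↔ f (Sum.inr B) < f (Sum.inr C) :=
    fun B C => Iff.rfl
  have hbetween : ∀ {x y k}, f x ≤ k → k ≤ f y → ∃ z, f z = k :=
    exists_eq_of_connected hconn fun x y => (hadj x y).1
  constructor
  · refine le_antisymm le_top ⟨fun v _ => ?_, fun v w hvw => ?_⟩
    · obtain ⟨B, hB, hv⟩ := exists_isBlock_mem (G := G) v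
      exact (le_iSup (fun B : BlockIndex G => B.1) ⟨B, hB⟩).1 hv
    · obtain ⟨B, hB, hv⟩ := exists_isBlock_adj (G := G) hvw
      exact (le_iSup (fun B : BlockIndex G => B.1) ⟨B, hB⟩).2 hv
  -- The node numbered just above `B` is a cut-vertex `c`, the one above `c` is a block `D`, and `D
  -- = C` because no block lies strictly between `B` and `C`.
  · intro B C hBC
    have hBC' := (hlt B C).1 hBC.lt
    obtain ⟨c, hc⟩ := hbetween (x := Sum.inr B) (y := Sum.inr C) (k := f (Sum.inr B) + 1)
      (by omega) (by omega)
    have hBc : (blockGraph G).Adj (Sum.inr B) c := (hadj _ _).2 (Or.inr hc)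
    rcases c with c | B'
    swap
    · exact absurd hBc not_blockGraph_adj_inr_inr
    have hcC : f (Sum.inl c) < f (Sum.inr C) := by
      refine lt_of_le_of_ne (by omega) fun h => ?_
      exact Sum.inl_ne_inr (hinj h)
    obtain ⟨D, hD⟩ := hbetween (x := Sum.inl c) (y := Sum.inr C) (k := f (Sum.inl c) + 1)
      (by omega) (by omega)
    have hcD : (blockGraph G).Adj (Sum.inl c) D := (hadj _ _).2 (Or.inr hD)
    rcases D with d | D
    · exact absurd hcD not_blockGraph_adj_inl_inl
    obtain rfl : D = C := by
      by_contra hne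
      have hne' : f (Sum.inr D) ≠ f (Sum.inr C) := fun h => hne (Sum.inr_injective (hinj h))
      exact hBC.2 ((hlt B D).2 (by omega)) ((hlt D C).2 (by omega))
    have hcB := blockGraph_adj_inr_inl.1 hBc
    have hcD := blockGraph_adj_inl_inr.1 hcD
    refine ⟨c, Set.Subset.antisymm (fun w hw => ?_) ?_⟩
    · exact B.2.subsingleton_inter D.2 (fun h => hBC.lt.ne (Subtype.ext h)) hcB hcD hw.1 hw.2
    · rintro w rfl
      exact ⟨hcB, hcD⟩
  -- A common vertex is a cut-vertex adjacent to both blocks, so their numbers differ by two and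
  -- leave no room for a block in between.
  · intro B C hBC hcov
    rw [Set.disjoint_left]
    intro v hvB hvC
    have hcut := B.2.isCutVertex C.2 (fun h => hBC.ne (Subtype.ext h)) hvB hvC
    have h1 := (hadj _ _).1 (blockGraph_adj_inr_inl (c := ⟨v, hcut⟩).2 hvB)
    have h2 := (hadj _ _).1 (blockGraph_adj_inr_inl (c := ⟨v, hcut⟩).2 hvC)
    have h3 := (hlt B C).1 hBC
    refine hcov ⟨hBC, fun D hBD hDC => ?_⟩
    have h4 := (hlt B D).1 hBD
    have h5 := (hlt D C).1 hDC
    exact Sum.inl_ne_inr (hinj (show f (Sum.inl ⟨v, hcut⟩) = f (Sum.inr D) by omega))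

end Chain

end ArcGraph

namespace ArcGraph

open SimpleGraph

/-! ### A path through a prescribed vertex (fan argument) -/

section Fan

variable {W : Type*} {H : SimpleGraph W}

lemma eq_of_mem_takeUntil_of_mem_dropUntil [DecidableEq W] {a b x y : W} {p : H.Walk a b}
    (hp : p.IsPath) (hy : y ∈ p.support) (h1 : x ∈ (p.takeUntil y hy).support)
    (h2 : x ∈ (p.dropUntil y hy).support) : x = y := by
  by_contra hne
  have hspec := p.take_spec hy
  rw [← hspec, Walk.isPath_def, Walk.support_append] at hp
  rw [← Walk.cons_tail_support] at h2
  exact (List.nodup_append.1 hp).2.2 _ h1 _ ((List.mem_cons.1 h2).resolve_left hne) rfl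

lemma isPath_append {a b c : W} {p : H.Walk a b} {q : H.Walk b c} (hp : p.IsPath) (hq : q.IsPath)
    (h : ∀ x ∈ p.support, x ∈ q.support → x = b) : (p.append q).IsPath := by
  rw [Walk.isPath_def] at *
  rw [Walk.support_append]
  rw [← Walk.cons_tail_support, List.nodup_cons] at hq
  refine List.nodup_append.2 ⟨hp, hq.2, ?_⟩
  rintro x hx _ hx' rfl
  exact hq.1 (h x hx (List.mem_of_mem_tail hx') ▸ hx')

lemma exists_walk_first_mem {a b : W} (p : H.Walk a b) {B : Set W} (hb : b ∈ B) :
    ∃ c ∈ B, ∃ q : H.Walk a c, q.support ⊆ p.support ∧ ∀ x ∈ q.support, x ∈ B → x = c := by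
  induction p with
  | nil => exact ⟨_, hb, Walk.nil, by simp, by simp⟩
  | @cons a a' b h p ih =>
    by_cases ha : a ∈ B
    · exact ⟨a, ha, Walk.nil, by simp, by simp⟩
    · obtain ⟨c, hc, q, hq, hq'⟩ := ih hb
      refine ⟨c, hc, Walk.cons h q, ?_, ?_⟩
      · simp only [Walk.support_cons]
        exact List.cons_subset_cons _ hq
      · intro x hx hxB
        rcases List.mem_cons.1 (by simpa using hx) with rfl | hx
        · exact absurd hxB ha
        · exact hq' x hx hxB

/-- A walk from `A` to `B` contains a walk from `A` to `B` whose inner vertices are in neither. -/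
lemma exists_walk_between {a b : W} (p : H.Walk a b) {A B : Set W} (ha : a ∈ A) (hb : b ∈ B) :
    ∃ c ∈ A, ∃ d ∈ B, ∃ q : H.Walk c d, q.support ⊆ p.support ∧
      (∀ x ∈ q.support, x ∈ A → x = c) ∧ ∀ x ∈ q.support, x ∈ B → x = d := by
  obtain ⟨d, hd, q, hq, hqB⟩ := exists_walk_first_mem p hb
  obtain ⟨c, hc, r, hr, hrA⟩ := exists_walk_first_mem q.reverse ha
  have hrq : r.support ⊆ q.support := fun x hx => by simpa using hr hx
  refine ⟨c, hc, d, hd, r.reverse, fun x hx => hq (hrq (by simpa using hx)), ?_, ?_⟩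
  · exact fun x hx => hrA x (by simpa using hx)
  · exact fun x hx => hqB x (hrq (by simpa using hx))

variable {b s t : W}

/-- Augmentation as in Menger's theorem, by induction on the length of the tail `R`. A path from `b`
avoiding `z` to `s` or `t` contains a segment `T` from `w` on `Q₁ ∪ Q₂` to `d` in `R ∪ {t}`, without
inner vertices in either set. If `d` is on `R`, then `T` and the initial part of `R` extend the two
paths to `d`, and the tail gets shorter. Otherwise `d = t`, and the two walks can be read off. -/
lemma exists_disjoint_walks_aux [DecidableEq W]
    (hfan : ∀ z, z ≠ b → (z ≠ s ∧ (del H z).Reachable b s) ∨ (z ≠ t ∧ (del H z).Reachable b t))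
    (n : ℕ) : ∀ (z : W) (Q₁ Q₂ : H.Walk b z) (R : H.Walk z s), R.length = n → z ≠ b →
      Q₁.IsPath → Q₂.IsPath → R.IsPath →
      (∀ x ∈ Q₁.support, x ∈ Q₂.support → x = b ∨ x = z) →
      (∀ x ∈ R.support, x ∈ Q₁.support → x = z) → (∀ x ∈ R.support, x ∈ Q₂.support → x = z) →
      ∃ (X : H.Walk b s) (Y : H.Walk b t), ∀ x ∈ X.support, x ∈ Y.support → x = b := by
  induction n using Nat.strong_induction_on with
  | _ n ih =>
    intro z Q₁ Q₂ R hn hzb hQ₁ hQ₂ hR h12 hR1 hR2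
    set A : Set W := {x | x ∈ Q₁.support ∨ x ∈ Q₂.support} with hA
    set B : Set W := {x | x = t ∨ (x ∈ R.support ∧ x ≠ z)} with hB
    obtain ⟨e, he, p, hp⟩ : ∃ e ∈ B, ∃ p : H.Walk b e, z ∉ p.support := by
      rcases hfan z hzb with ⟨h1, ⟨p⟩⟩ | ⟨h1, ⟨p⟩⟩
      · refine ⟨s, Or.inr ⟨R.end_mem_support, h1.symm⟩, p.mapLe del_le, ?_⟩
        rw [Walk.support_mapLe_eq_support]
        exact not_mem_support_of_walk_del p hzb.symm
      · refine ⟨t, Or.inl rfl, p.mapLe del_le, ?_⟩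
        rw [Walk.support_mapLe_eq_support]
        exact not_mem_support_of_walk_del p hzb.symm
    obtain ⟨w, hw, d, hd, T, hTp, hTA, hTB⟩ :=
      exists_walk_between p (A := A) (B := B) (Or.inl Q₁.start_mem_support) he
    have hzT : z ∉ T.support := fun h => hp (hTp h)
    have hwz : w ≠ z := by rintro rfl; exact hzT T.start_mem_support
    have hdz : d ≠ z := by rintro rfl; exact hzT T.end_mem_support
    -- The hypotheses are symmetric in `Q₁` and `Q₂`.
    wlog hw1 : w ∈ Q₁.support generalizing Q₁ Q₂
    · exact this Q₂ Q₁ hQ₂ hQ₁ (fun x h1 h2 => h12 x h2 h1) hR2 hR1 rfl hw.symm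
        (fun x hx h => hTA x hx h.symm) (hw.resolve_left hw1)
    set P := Q₁.takeUntil w hw1 with hP
    have hPQ : ∀ x ∈ P.support, x ∈ Q₁.support := fun x hx =>
      Q₁.support_takeUntil_subset_support hw1 hx
    have hzP : z ∉ P.support := fun h =>
      hwz (eq_of_mem_takeUntil_of_mem_dropUntil hQ₁ hw1 h (Walk.end_mem_support _)).symm
    have hP2 : ∀ x ∈ P.support, x ∈ Q₂.support → x = b := fun x h1 h2 =>
      (h12 x (hPQ x h1) h2).resolve_right fun h => hzP (h ▸ h1)
    have hPR : ∀ x ∈ P.support, x ∉ R.support := fun x h1 h2 =>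
      hzP (hR1 x h2 (hPQ x h1) ▸ h1)
    have hT2 : ∀ x ∈ T.support, x ∈ Q₂.support → x = b := by
      intro x h1 h2
      obtain rfl := hTA x h1 (Or.inr h2)
      exact (h12 x hw1 h2).resolve_right hwz
    have hTR : ∀ x ∈ T.support, x ∈ R.support → x = d := fun x h1 h2 =>
      hTB x h1 (Or.inr ⟨h2, fun h => hzT (h ▸ h1)⟩)
    by_cases hdR : d ∈ R.support
    · have hlen : (R.dropUntil d hdR).length < n := by
        have h1 := congrArg Walk.length (R.take_spec hdR)
        rw [Walk.length_append] at h1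
        have h2 : (R.takeUntil d hdR).length ≠ 0 := fun h => hdz (Walk.eq_of_length_eq_zero h).symm
        omega
      have htake : ∀ x ∈ (R.takeUntil d hdR).support, x ∈ R.support := fun x hx =>
        R.support_takeUntil_subset_support hdR hx
      have hdrop : ∀ x ∈ (R.dropUntil d hdR).support, x ∈ R.support := fun x hx =>
        R.support_dropUntil_subset_support hdR hx
      have hzdrop : z ∉ (R.dropUntil d hdR).support := fun h =>
        hdz (eq_of_mem_takeUntil_of_mem_dropUntil hR hdR (Walk.start_mem_support _) h).symm
      refine ih _ hlen d (P.append T).bypass (Q₂.append (R.takeUntil d hdR)).bypass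
        (R.dropUntil d hdR) rfl ?_ (Walk.bypass_isPath _) (Walk.bypass_isPath _)
        (hR.dropUntil hdR) ?_ ?_ ?_
      · rintro rfl
        exact hdz (hR1 d hdR Q₁.start_mem_support)
      · intro x h1 h2
        have h1 := Walk.support_bypass_subset_support _ h1
        have h2 := Walk.support_bypass_subset_support _ h2
        rw [Walk.mem_support_append_iff] at h1 h2
        rcases h1 with h1 | h1 <;> rcases h2 with h2 | h2
        · exact Or.inl (hP2 x h1 h2)
        · exact absurd (htake x h2) (hPR x h1)
        · exact Or.inl (hT2 x h1 h2)
        · exact Or.inr (hTR x h1 (htake x h2))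
      · intro x h1 h2
        have h2 := Walk.support_bypass_subset_support _ h2
        rw [Walk.mem_support_append_iff] at h2
        rcases h2 with h2 | h2
        · exact absurd (hdrop x h1) (hPR x h2)
        · exact hTR x h2 (hdrop x h1)
      · intro x h1 h2
        have h2 := Walk.support_bypass_subset_support _ h2
        rw [Walk.mem_support_append_iff] at h2
        rcases h2 with h2 | h2
        · exact absurd (hR2 x (hdrop x h1) h2 ▸ h1) hzdrop
        · exact eq_of_mem_takeUntil_of_mem_dropUntil hR hdR h2 h1
    · obtain rfl : d = t := hd.resolve_right fun h => hdR h.1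
      refine ⟨Q₂.append R, P.append T, fun x h1 h2 => ?_⟩
      rw [Walk.mem_support_append_iff] at h1 h2
      rcases h2 with h2 | h2 <;> rcases h1 with h1 | h1
      · exact hP2 x h2 h1
      · exact absurd h1 (hPR x h2)
      · exact hT2 x h2 h1
      · exact absurd (hTR x h2 h1 ▸ h1) hdR

/-- If no vertex other than `b` separates `b` from `{s, t}`, then some path from `s` to `t` passes
through `b`. -/
lemma exists_isPath_through (hbs : b ≠ s) (hreach : H.Reachable b s)
    (hfan : ∀ z, z ≠ b → (z ≠ s ∧ (del H z).Reachable b s) ∨ (z ≠ t ∧ (del H z).Reachable b t)) :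
    ∃ p : H.Walk s t, p.IsPath ∧ b ∈ p.support := by
  classical
  obtain ⟨X, Y, hXY⟩ : ∃ (X : H.Walk b s) (Y : H.Walk b t),
      ∀ x ∈ X.support, x ∈ Y.support → x = b := by
    obtain ⟨p, hp⟩ := hreach.exists_isPath
    cases p with
    | nil => exact absurd rfl hbs
    | @cons _ z _ h R =>
      rw [Walk.cons_isPath_iff] at hp
      -- The augmentation starts with both paths equal to the edge `bz`: its only vertices are the
      -- two ends, which the paths are allowed to share.
      have hQ : (Walk.cons h Walk.nil : H.Walk b z).IsPath := by
        simp [Walk.cons_isPath_iff, h.ne]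
      have hRQ : ∀ x ∈ R.support, x ∈ (Walk.cons h Walk.nil : H.Walk b z).support → x = z := by
        intro x h1 h2
        rcases (by simpa using h2 : x = b ∨ x = z) with rfl | h2
        · exact absurd h1 hp.2
        · exact h2
      exact exists_disjoint_walks_aux hfan _ z (Walk.cons h Walk.nil) (Walk.cons h Walk.nil) R rfl
        h.ne.symm hQ hQ hp.1 (fun x h1 _ => by simpa using h1) hRQ hRQ
  refine ⟨X.bypass.reverse.append Y.bypass,
    isPath_append (Walk.bypass_isPath _).reverse (Walk.bypass_isPath _) fun x h1 h2 => ?_, ?_⟩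
  · exact hXY x (Walk.support_bypass_subset_support _ (by simpa using h1))
      (Walk.support_bypass_subset_support _ h2)
  · rw [Walk.mem_support_append_iff]
    exact Or.inr (Walk.start_mem_support _)

/-- If `b` separates `s` from `t`, then some path from `s` to `t` passes through `b`. -/
lemma exists_isPath_through_of_separates (hH : H.Connected) (hbs : b ≠ s) (hbt : b ≠ t)
    (h : ¬ (del H b).Reachable s t) : ∃ p : H.Walk s t, p.IsPath ∧ b ∈ p.support := by
  refine exists_isPath_through hbs (hH.preconnected _ _) fun z hz => ?_
  by_contra! hcon
  -- If `z` separated `b` from both `s` and `t`, then `s` and `t` would be joined through `z`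
  -- avoiding `b`.
  have key : ∀ a, b ≠ a → (z ≠ a → ¬ (del H z).Reachable b a) → (del H b).Reachable a z := by
    intro a hba hza
    by_contra hn
    refine hza (by rintro rfl; exact hn (Reachable.refl _)) ?_
    exact (reachable_del_of_not_reachable_del (hH.preconnected a b) hba.symm hz hn).symm
  exact h ((key s hbs hcon.1).trans (key t hbt hcon.2).symm)

end Fan

/-! ### The subdivision, whose vertices are the cells of the 1-complex -/

section Subdivision

variable {V : Type u} {G : SimpleGraph V}

/-- The graph obtained from `G` by putting a new vertex on every edge. -/
def subdiv (G : SimpleGraph V) : SimpleGraph (V ⊕ G.edgeSet) :=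
  SimpleGraph.fromRel fun n m => ∃ v e, n = Sum.inl v ∧ m = Sum.inr e ∧ v ∈ e.1

lemma subdiv_adj_inl_inr {v : V} {e : G.edgeSet} :
    (subdiv G).Adj (Sum.inl v) (Sum.inr e) ↔ v ∈ e.1 := by
  simp [subdiv]

lemma subdiv_adj_inr_inl {v : V} {e : G.edgeSet} :
    (subdiv G).Adj (Sum.inr e) (Sum.inl v) ↔ v ∈ e.1 := by
  rw [adj_comm, subdiv_adj_inl_inr]

lemma not_subdiv_adj_inl_inl {v w : V} : ¬ (subdiv G).Adj (Sum.inl v) (Sum.inl w) := by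
  simp [subdiv]

lemma not_subdiv_adj_inr_inr {e f : G.edgeSet} : ¬ (subdiv G).Adj (Sum.inr e) (Sum.inr f) := by
  simp [subdiv]

lemma subdiv_reachable {a b : V} (h : G.Reachable a b) :
    (subdiv G).Reachable (Sum.inl a) (Sum.inl b) := by
  obtain ⟨p⟩ := h
  induction p with
  | nil => exact Reachable.refl _
  | @cons a a' b hadj p ih =>
    exact ((subdiv_adj_inl_inr (e := ⟨s(a, a'), hadj⟩).2 (Sym2.mem_mk_left _ _)).reachable.trans
      (subdiv_adj_inr_inl.2 (Sym2.mem_mk_right _ _)).reachable).trans ih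

lemma subdiv_del_reachable {x a b : V} (h : (del G x).Reachable a b) :
    (del (subdiv G) (Sum.inl x)).Reachable (Sum.inl a) (Sum.inl b) := by
  obtain ⟨p⟩ := h
  induction p with
  | nil => exact Reachable.refl _
  | @cons a a' b hadj p ih =>
    refine Reachable.trans ?_ ih
    have h1 : (del (subdiv G) (Sum.inl x)).Adj (Sum.inl a) (Sum.inr ⟨s(a, a'), hadj.1⟩) :=
      ⟨subdiv_adj_inl_inr.2 (Sym2.mem_mk_left _ _), by simpa using hadj.2.1, by simp⟩
    have h2 : (del (subdiv G) (Sum.inl x)).Adj (Sum.inr ⟨s(a, a'), hadj.1⟩) (Sum.inl a') :=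
      ⟨subdiv_adj_inr_inl.2 (Sym2.mem_mk_right _ _), by simp, by simpa using hadj.2.2⟩
    exact h1.reachable.trans h2.reachable

lemma subdiv_connected (hG : G.Connected) : (subdiv G).Connected := by
  obtain ⟨v⟩ := hG.nonempty
  have h : ∀ n, (subdiv G).Reachable n (Sum.inl v) := by
    rintro (w | e)
    · exact subdiv_reachable (hG.preconnected w v)
    · exact (subdiv_adj_inr_inl.2 (Sym2.out_fst_mem e.1)).reachable.trans
        (subdiv_reachable (hG.preconnected _ v))
  have : Nonempty (V ⊕ G.edgeSet) := ⟨Sum.inl v⟩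
  exact ⟨fun n m => (h n).trans (h m).symm⟩

/-- If the midpoint of the edge `e` separates `b` from `s` and `t`, then so does an end of `e`. -/
lemma exists_vertex_separates (hG : G.Connected) {e : G.edgeSet} {b s t : V ⊕ G.edgeSet}
    (hb : b ≠ Sum.inr e) (hs : s ≠ Sum.inr e) (ht : t ≠ Sum.inr e)
    (hbs : ¬ (del (subdiv G) (Sum.inr e)).Reachable b s)
    (hbt : ¬ (del (subdiv G) (Sum.inr e)).Reachable b t) :
    ∃ y : V, b ≠ Sum.inl y ∧ ¬ (del (subdiv G) (Sum.inl y)).Reachable b s ∧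
      ¬ (del (subdiv G) (Sum.inl y)).Reachable b t := by
  set K : Set (V ⊕ G.edgeSet) := {n | (del (subdiv G) (Sum.inr e)).Reachable b n} with hK
  -- `y` is the end of `e` through which `s` reaches `e`, so it lies outside the component `K` of
  -- `b`.
  obtain ⟨x, y, hxy, hyK⟩ : ∃ x y, e.1 = s(x, y) ∧ Sum.inl y ∉ K := by
    obtain ⟨n, hn, hsn⟩ :=
      exists_adj_reachable_del ((subdiv_connected hG).preconnected s (Sum.inr e)) hs
    rcases n with y | f
    · have hy := subdiv_adj_inl_inr.1 hn
      obtain ⟨x, hx⟩ := Sym2.mem_iff_exists.1 hy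
      exact ⟨x, y, by rw [hx, Sym2.eq_swap], fun h => hbs (Reachable.trans h hsn.symm)⟩
    · exact absurd hn not_subdiv_adj_inr_inr
  -- With `y` removed, a walk from `b` can leave `K` only to `e`, coming from the other end `x`, and
  -- from `e` it can only return to `x`.
  have hmem : ∀ n, (del (subdiv G) (Sum.inl y)).Reachable b n →
      n ∈ K ∨ (n = Sum.inr e ∧ Sum.inl x ∈ K) := by
    rintro n ⟨q⟩
    suffices ∀ m, (m ∈ K ∨ (m = Sum.inr e ∧ Sum.inl x ∈ K)) →
        (del (subdiv G) (Sum.inl y)).Walk m n → n ∈ K ∨ (n = Sum.inr e ∧ Sum.inl x ∈ K) from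
      this b (Or.inl (Reachable.refl _)) q
    intro m hm p
    clear q
    induction p with
    | nil => exact hm
    | @cons m m' n h p ih =>
      refine ih ?_
      rcases hm with hm | ⟨rfl, hx⟩
      · have hme := ne_of_reachable_del hm hb
        by_cases hm' : m' = Sum.inr e
        · subst hm'
          rcases m with v | f
          · have hv := subdiv_adj_inl_inr.1 h.1
            rw [hxy, Sym2.mem_iff] at hv
            rcases hv with rfl | rfl
            · exact Or.inr ⟨rfl, hm⟩
            · exact absurd rfl h.2.1
          · exact absurd h.1 not_subdiv_adj_inr_inr
        · exact Or.inl (Reachable.trans hm (Adj.reachable ⟨h.1, hme, hm'⟩))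
      · rcases m' with v | f
        · have hv := subdiv_adj_inr_inl.1 h.1
          rw [hxy, Sym2.mem_iff] at hv
          rcases hv with rfl | rfl
          · exact Or.inl hx
          · exact absurd rfl h.2.2
        · exact absurd h.1 not_subdiv_adj_inr_inr
  refine ⟨y, ?_, fun h => ?_, fun h => ?_⟩
  · rintro rfl; exact hyK (Reachable.refl _)
  · rcases hmem s h with h | h
    · exact hbs h
    · exact hs h.1
  · rcases hmem t h with h | h
    · exact hbt h
    · exact ht h.1

end Subdivision

/-! ### Chains of 2-connected links: any three cells lie on a path -/

section ChainPaths

variable {V : Type u} {G : SimpleGraph V}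

/-- The cells of the realization of a subgraph. -/
def cells (L : G.Subgraph) : Set (V ⊕ G.edgeSet)
  | Sum.inl v => v ∈ L.verts
  | Sum.inr e => e.1 ∈ L.edgeSet

lemma exists_vertex_of_mem_cells {L : G.Subgraph} {n : V ⊕ G.edgeSet} (hn : n ∈ cells L) {x : V}
    (hx : n ≠ Sum.inl x) :
    ∃ r ∈ L.verts, r ≠ x ∧ (del (subdiv G) (Sum.inl x)).Reachable n (Sum.inl r) := by
  rcases n with v | ⟨e, he⟩
  · exact ⟨v, hn, fun h => hx (congrArg _ h), Reachable.refl _⟩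
  · induction e with
    | h a b =>
      have hab : L.Adj a b := hn
      by_cases ha : a = x
      · have hb : b ≠ x := fun hb => hab.ne (ha.trans hb.symm)
        exact ⟨b, L.edge_vert hab.symm, hb, Adj.reachable
          ⟨subdiv_adj_inr_inl.2 (Sym2.mem_mk_right a b), by simp, by simpa using hb⟩⟩
      · exact ⟨a, L.edge_vert hab, ha, Adj.reachable
          ⟨subdiv_adj_inr_inl.2 (Sym2.mem_mk_left a b), by simp, by simpa using ha⟩⟩

/-- From a set `A` that can only be left through `L` one reaches `L` within `A`. -/
lemma exists_reachable_of_closed {A S : Set V} (hA : ∀ a b, a ∈ A → a ∉ S → G.Adj a b → b ∈ A)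
    {x r s : V} (hx : x ∉ A) (hr : r ∈ A) (hs : s ∈ S) (h : G.Reachable r s) :
    ∃ w ∈ A, w ∈ S ∧ (del G x).Reachable r w := by
  obtain ⟨p⟩ := h
  induction p with
  | nil => exact ⟨_, hr, hs, Reachable.refl _⟩
  | @cons r r' s hadj p ih =>
    by_cases hrS : r ∈ S
    · exact ⟨r, hr, hrS, Reachable.refl _⟩
    · have hr' := hA r r' hr hrS hadj
      obtain ⟨w, hwA, hwS, hw⟩ := ih hr' hs
      have hadj' : (del G x).Adj r r' :=
        ⟨hadj, by rintro rfl; exact hx hr, by rintro rfl; exact hx hr'⟩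
      exact ⟨w, hwA, hwS, hadj'.reachable.trans hw⟩

variable {ι : Type u} [LinearOrder ι] {L : ι → G.Subgraph}

lemma IsChainOfLinks.exists_adj (hL : IsChainOfLinks G L) {a b : V} (h : G.Adj a b) :
    ∃ i, (L i).Adj a b := by
  have h' : (⨆ i, L i).Adj a b := by rw [hL.iSup_eq_top]; exact h
  simpa using h'

lemma IsChainOfLinks.exists_mem_cells (hL : IsChainOfLinks G L) (n : V ⊕ G.edgeSet) :
    ∃ i, n ∈ cells (L i) := by
  rcases n with v | ⟨e, he⟩
  · have h : v ∈ (⨆ i, L i).verts := by rw [hL.iSup_eq_top]; trivial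
    obtain ⟨i, hi⟩ : ∃ i, v ∈ (L i).verts := by simpa using h
    exact ⟨i, hi⟩
  · induction e with
    | h a b => exact hL.exists_adj he

/-- In a chain of `2`-connected links a vertex does not separate a middle vertex from both a
vertex before it and a vertex behind it. -/
lemma IsChainOfLinks.reachable_del (hG : G.Connected) (hL : IsChainOfLinks G L)
    (h2 : ∀ i, IsTwoConnected (L i).coe) {i j k : ι} (hij : i ≤ j) (hjk : j ≤ k) {x r s t : V}
    (hr : r ∈ (L i).verts) (hs : s ∈ (L j).verts) (ht : t ∈ (L k).verts) (hrx : r ≠ x)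
    (hsx : s ≠ x) (htx : t ≠ x) :
    (del G x).Reachable s r ∨ (del G x).Reachable s t := by
  have hdisj : ∀ i k, i < j → j < k → ∀ v, v ∈ (L i).verts → v ∈ (L k).verts → False :=
    fun i k hi hk v h1 h2 => Set.disjoint_left.1
      (hL.disjoint i k (hi.trans hk) fun h => h.2 hi hk) h1 h2
  rcases hij.eq_or_lt with rfl | hij
  · exact Or.inl ((h2 i).reachable_del hs hr hsx hrx)
  rcases hjk.eq_or_lt with rfl | hjk
  · exact Or.inr ((h2 j).reachable_del hs ht hsx htx)
  -- `A` will be the union of all links on one side of `L j`. If `x` is not in it, one walks within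
  -- `A` to `L j` and then inside `L j`, where 2-connectedness avoids `x`.
  have key : ∀ A : Set V, (∀ a b, a ∈ A → a ∉ (L j).verts → G.Adj a b → b ∈ A) → x ∉ A →
      ∀ r ∈ A, (del G x).Reachable s r := by
    intro A hA hxA r hr
    obtain ⟨w, hwA, hwS, hw⟩ := exists_reachable_of_closed hA hxA hr hs (hG.preconnected r s)
    exact ((h2 j).reachable_del hs hwS hsx (by rintro rfl; exact hxA hwA)).trans hw.symm
  -- Links on opposite sides of `L j` are disjoint, so at least one side avoids `x`.
  by_cases hx : ∃ l < j, x ∈ (L l).verts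
  · right
    obtain ⟨l, hl, hxl⟩ := hx
    refine key {v | ∃ m, j < m ∧ v ∈ (L m).verts} ?_ ?_ t ⟨k, hjk, ht⟩
    · rintro a b ⟨m, hm, ha⟩ haj hab
      obtain ⟨m', hm'⟩ := hL.exists_adj hab
      have ha' := (L m').edge_vert hm'
      rcases lt_trichotomy m' j with h | rfl | h
      · exact (hdisj m' m h hm a ha' ha).elim
      · exact absurd ha' haj
      · exact ⟨m', h, (L m').edge_vert hm'.symm⟩
    · rintro ⟨m, hm, hxm⟩
      exact hdisj l m hl hm x hxl hxm
  · left
    refine key {v | ∃ m, m < j ∧ v ∈ (L m).verts} ?_ (fun ⟨m, hm, hxm⟩ => hx ⟨m, hm, hxm⟩) r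
      ⟨i, hij, hr⟩
    rintro a b ⟨m, hm, ha⟩ haj hab
    obtain ⟨m', hm'⟩ := hL.exists_adj hab
    have ha' := (L m').edge_vert hm'
    rcases lt_trichotomy m' j with h | rfl | h
    · exact ⟨m', h, (L m').edge_vert hm'.symm⟩
    · exact absurd ha' haj
    · exact (hdisj m m' hm h a ha ha').elim

lemma IsChainOfLinks.subdiv_reachable_del (hG : G.Connected) (hL : IsChainOfLinks G L)
    (h2 : ∀ i, IsTwoConnected (L i).coe) {i j k : ι} (hij : i ≤ j) (hjk : j ≤ k) {x : V}
    {r s t : V ⊕ G.edgeSet} (hr : r ∈ cells (L i)) (hs : s ∈ cells (L j)) (ht : t ∈ cells (L k))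
    (hrx : r ≠ Sum.inl x) (hsx : s ≠ Sum.inl x) (htx : t ≠ Sum.inl x) :
    (del (subdiv G) (Sum.inl x)).Reachable s r ∨ (del (subdiv G) (Sum.inl x)).Reachable s t := by
  obtain ⟨r', hr', hrx', hrr'⟩ := exists_vertex_of_mem_cells hr hrx
  obtain ⟨s', hs', hsx', hss'⟩ := exists_vertex_of_mem_cells hs hsx
  obtain ⟨t', ht', htx', htt'⟩ := exists_vertex_of_mem_cells ht htx
  rcases hL.reachable_del hG h2 hij hjk hr' hs' ht' hrx' hsx' htx' with h | h
  · exact Or.inl ((hss'.trans (subdiv_del_reachable h)).trans hrr'.symm)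
  · exact Or.inr ((hss'.trans (subdiv_del_reachable h)).trans htt'.symm)

/-- In a chain of `2`-connected links any three cells lie on a path of the subdivision. -/
lemma IsChainOfLinks.exists_isPath (hG : G.Connected) (hL : IsChainOfLinks G L)
    (h2 : ∀ i, IsTwoConnected (L i).coe) {n₁ n₂ n₃ : V ⊕ G.edgeSet} (h12 : n₁ ≠ n₂) (h13 : n₁ ≠ n₃)
    (h23 : n₂ ≠ n₃) : ∃ (a b : V ⊕ G.edgeSet) (p : (subdiv G).Walk a b), p.IsPath ∧
      n₁ ∈ p.support ∧ n₂ ∈ p.support ∧ n₃ ∈ p.support := by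
  have hH := subdiv_connected hG
  by_cases s1 : (del (subdiv G) n₁).Reachable n₂ n₃
  swap
  · obtain ⟨p, hp, hb⟩ := exists_isPath_through_of_separates hH h12 h13 s1
    exact ⟨_, _, p, hp, hb, p.start_mem_support, p.end_mem_support⟩
  by_cases s2 : (del (subdiv G) n₂).Reachable n₁ n₃
  swap
  · obtain ⟨p, hp, hb⟩ := exists_isPath_through_of_separates hH h12.symm h23 s2
    exact ⟨_, _, p, hp, p.start_mem_support, hb, p.end_mem_support⟩
  by_cases s3 : (del (subdiv G) n₃).Reachable n₁ n₂
  swap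
  · obtain ⟨p, hp, hb⟩ := exists_isPath_through_of_separates hH h13.symm h23.symm s3
    exact ⟨_, _, p, hp, p.start_mem_support, p.end_mem_support, hb⟩
  -- Now none of the three cells separates the other two. A `z` separating the middle cell `s` from
  -- both `r` and `t` is therefore neither of them. If `z` is an edge, one of its ends separates as
  -- well, and `hvert` rules out vertices, including `r` and `t` themselves.
  have key : ∀ (i j k : ι) (r s t : V ⊕ G.edgeSet), i ≤ j → j ≤ k → r ∈ cells (L i) →
      s ∈ cells (L j) → t ∈ cells (L k) → s ≠ r → s ≠ t → (del (subdiv G) r).Reachable s t →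
      (del (subdiv G) t).Reachable s r → ∃ p : (subdiv G).Walk r t, p.IsPath ∧ s ∈ p.support := by
    intro i j k r s t hij hjk hr hs ht hsr hst hsep hsep'
    refine exists_isPath_through hsr (hH.preconnected _ _) fun z hz => ?_
    by_contra! hcon
    obtain ⟨hc1, hc2⟩ := hcon
    have hzr : z ≠ r := by
      rintro rfl
      exact hc2 (ne_of_reachable_del hsep hsr).symm hsep
    have hzt : z ≠ t := by
      rintro rfl
      exact hc1 (ne_of_reachable_del hsep' hst).symm hsep'
    have hvert : ∀ x : V, s ≠ Sum.inl x → ¬ (del (subdiv G) (Sum.inl x)).Reachable s r →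
        ¬ (del (subdiv G) (Sum.inl x)).Reachable s t → False := by
      intro x hsx h1 h2'
      have hrx : r ≠ Sum.inl x := by rintro rfl; exact h2' hsep
      have htx : t ≠ Sum.inl x := by rintro rfl; exact h1 hsep'
      rcases hL.subdiv_reachable_del hG h2 hij hjk hr hs ht hrx hsx htx with h | h
      · exact h1 h
      · exact h2' h
    rcases z with x | e
    · exact hvert x hz.symm (hc1 hzr) (hc2 hzt)
    · obtain ⟨y, hy, hy1, hy2⟩ := exists_vertex_separates hG hz.symm hzr.symm hzt.symm (hc1 hzr)
        (hc2 hzt)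
      exact hvert y hy hy1 hy2
  obtain ⟨i, hi⟩ := hL.exists_mem_cells n₁
  obtain ⟨j, hj⟩ := hL.exists_mem_cells n₂
  obtain ⟨k, hk⟩ := hL.exists_mem_cells n₃
  rcases le_total i j with hij | hij <;> rcases le_total j k with hjk | hjk <;>
    rcases le_total i k with hik | hik
  · obtain ⟨p, hp, h⟩ := key i j k n₁ n₂ n₃ hij hjk hi hj hk h12.symm h23 s1 s3.symm
    exact ⟨_, _, p, hp, p.start_mem_support, h, p.end_mem_support⟩
  · obtain ⟨p, hp, h⟩ := key i j k n₁ n₂ n₃ hij hjk hi hj hk h12.symm h23 s1 s3.symm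
    exact ⟨_, _, p, hp, p.start_mem_support, h, p.end_mem_support⟩
  · obtain ⟨p, hp, h⟩ := key i k j n₁ n₃ n₂ hik hjk hi hk hj h13.symm h23.symm s1.symm s2.symm
    exact ⟨_, _, p, hp, p.start_mem_support, p.end_mem_support, h⟩
  · obtain ⟨p, hp, h⟩ := key k i j n₃ n₁ n₂ hik hij hk hi hj h13 h12 s3 s2
    exact ⟨_, _, p, hp, h, p.end_mem_support, p.start_mem_support⟩
  · obtain ⟨p, hp, h⟩ := key j i k n₂ n₁ n₃ hij hik hj hi hk h12 h13 s2 s3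
    exact ⟨_, _, p, hp, h, p.start_mem_support, p.end_mem_support⟩
  · obtain ⟨p, hp, h⟩ := key j k i n₂ n₃ n₁ hjk hik hj hk hi h23.symm h13.symm s2.symm s1.symm
    exact ⟨_, _, p, hp, p.end_mem_support, p.start_mem_support, h⟩
  · obtain ⟨p, hp, h⟩ := key k j i n₃ n₂ n₁ hjk hij hk hj hi h23 h12.symm s3.symm s1
    exact ⟨_, _, p, hp, p.end_mem_support, h, p.start_mem_support⟩
  · obtain ⟨p, hp, h⟩ := key k j i n₃ n₂ n₁ hjk hij hk hj hi h23 h12.symm s3.symm s1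
    exact ⟨_, _, p, hp, p.end_mem_support, h, p.start_mem_support⟩

end ChainPaths

end ArcGraph

namespace ArcGraph

open SimpleGraph Set

/-! ### Arcs as injective paths -/

section Arcs

variable {X : Type u} [TopologicalSpace X]

/-- `A` is the trace of an injective path from `x` to `y`. -/
def ArcFromTo (A : Set X) (x y : X) : Prop :=
  ∃ γ : Path x y, Function.Injective γ ∧ range γ = A

lemma ArcFromTo.isArc [T2Space X] {A : Set X} {x y : X} (h : ArcFromTo A x y) : IsArc A := by
  obtain ⟨γ, hγ, rfl⟩ := h
  exact ⟨(γ.continuous.isClosedEmbedding hγ).isEmbedding.toHomeomorph.symm⟩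

lemma ArcFromTo.symm {A : Set X} {x y : X} (h : ArcFromTo A x y) : ArcFromTo A y x := by
  obtain ⟨γ, hγ, rfl⟩ := h
  exact ⟨γ.symm, hγ.comp unitInterval.symm_involutive.injective, γ.symm_range⟩

lemma ArcFromTo.right_mem {A : Set X} {x y : X} (h : ArcFromTo A x y) : y ∈ A := by
  obtain ⟨γ, hγ, rfl⟩ := h
  exact ⟨1, γ.target⟩

lemma ArcFromTo.trans {A B : Set X} {x y z : X} (hA : ArcFromTo A x y) (hB : ArcFromTo B y z)
    (hAB : ∀ p ∈ A, p ∈ B → p = y) : ArcFromTo (A ∪ B) x z := by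
  obtain ⟨γ, hγ, rfl⟩ := hA
  obtain ⟨γ', hγ', rfl⟩ := hB
  refine ⟨γ.trans γ', ?_, γ.trans_range γ'⟩
  -- A common point of the two halves is `y`, which the second path takes only at its start.
  have key : ∀ s t : unitInterval, (s : ℝ) ≤ 1 / 2 → ¬ (t : ℝ) ≤ 1 / 2 →
      (γ.trans γ') s ≠ (γ.trans γ') t := by
    intro s t hs ht h
    rw [Path.trans_apply, Path.trans_apply, dif_pos hs, dif_neg ht] at h
    have h1 := hAB _ ⟨_, rfl⟩ ⟨_, h.symm⟩
    rw [h] at h1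
    have h2 := congrArg Subtype.val (hγ' (h1.trans γ'.source.symm))
    simp only [Icc.coe_zero] at h2
    linarith
  intro s t h
  by_cases hs : (s : ℝ) ≤ 1 / 2 <;> by_cases ht : (t : ℝ) ≤ 1 / 2
  · rw [Path.trans_apply, Path.trans_apply, dif_pos hs, dif_pos ht] at h
    have h1 := congrArg Subtype.val (hγ h)
    simp only at h1
    exact Subtype.ext (by linarith)
  · exact absurd h (key s t hs ht)
  · exact absurd h.symm (key t s ht hs)
  · rw [Path.trans_apply, Path.trans_apply, dif_neg hs, dif_neg ht] at h
    have h1 := congrArg Subtype.val (hγ' h)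
    simp only at h1
    exact Subtype.ext (by linarith)

/-- Like `ArcFromTo`, but a single point is allowed as well. -/
def PointOrArc (A : Set X) (x y : X) : Prop :=
  ArcFromTo A x y ∨ (A = {x} ∧ y = x)

lemma ArcFromTo.trans_pointOrArc {A B : Set X} {x y z : X} (hA : ArcFromTo A x y)
    (hB : PointOrArc B y z) (hAB : ∀ p ∈ A, p ∈ B → p = y) : ArcFromTo (A ∪ B) x z := by
  rcases hB with hB | ⟨rfl, rfl⟩
  · exact hA.trans hB hAB
  · rwa [union_eq_self_of_subset_right (singleton_subset_iff.2 hA.right_mem)]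

lemma arcFromTo_image_Icc {f : unitInterval → X} (hf : Continuous f) (hinj : Function.Injective f)
    {s t : unitInterval} (hst : s < t) : ArcFromTo (f '' Icc s t) (f s) (f t) := by
  have hst' : (s : ℝ) < t := hst
  have hmem : ∀ r : unitInterval, (s : ℝ) + r * (t - s) ∈ unitInterval := fun r => by
    have h1 := r.2.1
    have h2 := r.2.2
    have h3 := s.2.1
    have h4 := t.2.2
    constructor <;> nlinarith
  refine ⟨⟨⟨fun r => f ⟨s + r * (t - s), hmem r⟩, ?_⟩, ?_, ?_⟩, ?_, ?_⟩
  · exact hf.comp (by fun_prop)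
  · simp
  · simp
  · intro r r' h
    have h1 : (s : ℝ) + r * (t - s) = s + r' * (t - s) := congrArg Subtype.val (hinj h)
    exact Subtype.ext (mul_right_cancel₀ (sub_pos.2 hst').ne' (add_left_cancel h1))
  · ext p
    constructor
    · rintro ⟨r, rfl⟩
      have h1 := r.2.1
      have h2 := r.2.2
      refine ⟨_, ⟨?_, ?_⟩, rfl⟩
      · show (s : ℝ) ≤ s + r * (t - s)
        nlinarith
      · show (s : ℝ) + r * (t - s) ≤ t
        nlinarith
    · rintro ⟨q, ⟨h1, h2⟩, rfl⟩
      have h1 : (s : ℝ) ≤ q := h1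
      have h2 : (q : ℝ) ≤ t := h2
      have h3 : (0 : ℝ) < t - s := sub_pos.2 hst'
      refine ⟨⟨(q - s) / (t - s), div_nonneg (by linarith) h3.le,
        (div_le_one h3).2 (by linarith)⟩, ?_⟩
      refine congrArg f (Subtype.ext ?_)
      show (s : ℝ) + (q - s) / (t - s) * (t - s) = q
      field_simp
      ring

end Arcs

/-! ### Cells of the 1-complex, and arcs from paths of the subdivision -/

section Realization

variable {V : Type u} {G : SimpleGraph V}

/-- The first end of an edge, at parameter `0`. -/
noncomputable def tail (e : G.edgeSet) : V := (Quot.out (e : Sym2 V)).1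

/-- The second end of an edge, at parameter `1`. -/
noncomputable def head (e : G.edgeSet) : V := (Quot.out (e : Sym2 V)).2

lemma mk_tail_head (e : G.edgeSet) : s(tail e, head e) = e.1 := Quot.out_eq e.1

lemma adj_tail_head (e : G.edgeSet) : G.Adj (tail e) (head e) := by
  have h := e.2
  rwa [← mk_tail_head e, mem_edgeSet] at h

lemma mem_iff_tail_or_head {e : G.edgeSet} {v : V} : v ∈ e.1 ↔ v = tail e ∨ v = head e := by
  rw [← mk_tail_head e, Sym2.mem_iff]

/-- A vertex as a point of the realization. -/
def vtx (v : V) : Realization G := Quot.mk _ (Sum.inl v)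

/-- The point with parameter `t` on the edge `e`. -/
def edgePt (e : G.edgeSet) (t : unitInterval) : Realization G := Quot.mk _ (Sum.inr ⟨e, t⟩)

lemma edgePt_zero (e : G.edgeSet) : edgePt e 0 = vtx (tail e) := Quot.sound (Glue.zero e)

lemma edgePt_one (e : G.edgeSet) : edgePt e 1 = vtx (head e) := Quot.sound (Glue.one e)

lemma continuous_edgePt (e : G.edgeSet) : Continuous (edgePt e) := by
  let _ : TopologicalSpace V := ⊥
  have h : Continuous (Quot.mk (Glue G)) := continuous_quot_mk
  exact h.comp (continuous_inr.comp continuous_sigmaMk)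

lemma eq_vtx_or_eq_edgePt (x : Realization G) :
    (∃ v, x = vtx v) ∨ ∃ e t, 0 < t ∧ t < 1 ∧ x = edgePt e t := by
  induction x using Quot.ind with
  | _ x =>
    rcases x with v | ⟨e, t⟩
    · exact Or.inl ⟨v, rfl⟩
    · rcases eq_or_ne t 0 with rfl | h0
      · exact Or.inl ⟨_, edgePt_zero e⟩
      rcases eq_or_ne t 1 with rfl | h1
      · exact Or.inl ⟨_, edgePt_one e⟩
      exact Or.inr ⟨e, t, unitInterval.pos_iff_ne_zero.2 h0, unitInterval.lt_one_iff_ne_one.2 h1,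
        rfl⟩

/-- The universal property of the quotient. The real functions built this way show that cells are
disjoint, points are separated and cut-vertices are unavoidable. -/
lemma exists_continuous_lift (φ : V → ℝ) (ψ : G.edgeSet → unitInterval → ℝ)
    (hψ : ∀ e, Continuous (ψ e)) (h0 : ∀ e, ψ e 0 = φ (tail e)) (h1 : ∀ e, ψ e 1 = φ (head e)) :
    ∃ f : Realization G → ℝ, Continuous f ∧ (∀ v, f (vtx v) = φ v) ∧
      ∀ e t, f (edgePt e t) = ψ e t := by
  let _ : TopologicalSpace V := ⊥
  have : DiscreteTopology V := ⟨rfl⟩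
  have hcont : Continuous (Sum.elim φ fun p : (Σ _ : G.edgeSet, unitInterval) => ψ p.1 p.2) :=
    continuous_sumElim.2 ⟨continuous_of_discreteTopology, continuous_sigma hψ⟩
  refine ⟨Quot.lift (Sum.elim φ fun p => ψ p.1 p.2) ?_, continuous_quot_lift _ hcont,
    fun _ => rfl, fun _ _ => rfl⟩
  rintro _ _ (e | e)
  · exact h0 e
  · exact h1 e

/-- A function on the vertices extends linearly along the edges. -/
lemma exists_linear_extension (φ : V → ℝ) : ∃ f : Realization G → ℝ, Continuous f ∧
    (∀ v, f (vtx v) = φ v) ∧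
      ∀ e t, f (edgePt e t) = (1 - (t : ℝ)) * φ (tail e) + t * φ (head e) :=
  exists_continuous_lift φ (fun e t => (1 - (t : ℝ)) * φ (tail e) + t * φ (head e))
    (fun e => by fun_prop) (by simp) (by simp)

/-- A function that is positive exactly in the interior of a given edge. -/
lemma exists_tent (e : G.edgeSet) : ∃ f : Realization G → ℝ, Continuous f ∧
    (∀ v, f (vtx v) = 0) ∧ (∀ t, f (edgePt e t) = t * (1 - (t : ℝ))) ∧
      ∀ e' t, e' ≠ e → f (edgePt e' t) = 0 := by
  classical
  obtain ⟨f, hf, h1, h2⟩ := exists_continuous_lift (G := G) (fun _ => 0)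
    (fun e' t => if e' = e then t * (1 - (t : ℝ)) else 0)
    (fun e' => by split_ifs <;> fun_prop) (by simp) (by simp)
  exact ⟨f, hf, h1, fun t => by simp [h2], fun e' t h => by simp [h2, h]⟩

/-- The open cell of the realization that belongs to a vertex or an edge. -/
def openCell : V ⊕ G.edgeSet → Set (Realization G)
  | Sum.inl v => {vtx v}
  | Sum.inr e => edgePt e '' Ioo 0 1

lemma vtx_injective : Function.Injective (vtx : V → Realization G) := by
  classical
  intro v w h
  obtain ⟨f, -, hf, -⟩ := exists_linear_extension (G := G) (fun u => if u = v then 1 else 0)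
  have h1 := hf w
  rw [← h, hf v] at h1
  by_contra hne
  simp [Ne.symm hne] at h1

lemma edgePt_injective (e : G.edgeSet) : Function.Injective (edgePt e) := by
  classical
  intro s t h
  obtain ⟨f, -, -, hf⟩ := exists_linear_extension (G := G) (fun u => if u = tail e then 1 else 0)
  have h1 := hf e s
  rw [h, hf e t] at h1
  simp only [if_neg (adj_tail_head e).ne.symm, if_true] at h1
  exact Subtype.ext (by linarith)

lemma tent_pos {t : unitInterval} (h0 : 0 < t) (h1 : t < 1) : 0 < (t : ℝ) * (1 - t) := by
  have h0 : (0 : ℝ) < t := h0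
  have h1 : (t : ℝ) < 1 := h1
  exact mul_pos h0 (sub_pos.2 h1)

lemma eq_of_mem_openCell {n m : V ⊕ G.edgeSet} {x : Realization G} (hn : x ∈ openCell n)
    (hm : x ∈ openCell m) : n = m := by
  have key : ∀ (v : V) (e : G.edgeSet), x ∈ openCell (Sum.inl v) → x ∈ openCell (Sum.inr e) →
      False := by
    rintro v e rfl ⟨t, ⟨h0, h1⟩, ht⟩
    obtain ⟨f, -, hf1, hf2, -⟩ := exists_tent e
    have := hf2 t
    rw [ht, hf1] at this
    exact (tent_pos h0 h1).ne this
  rcases n with v | e <;> rcases m with w | e'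
  · exact congrArg _ (vtx_injective ((show x = vtx v from hn).symm.trans hm))
  · exact (key v e' hn hm).elim
  · exact (key w e hm hn).elim
  · obtain ⟨s, -, rfl⟩ := hn
    obtain ⟨t, ⟨h0, h1⟩, ht⟩ := hm
    by_contra hne
    obtain ⟨f, -, -, hf2, hf3⟩ := exists_tent e'
    have := hf2 t
    rw [ht, hf3 e s (fun h => hne (congrArg _ h))] at this
    exact (tent_pos h0 h1).ne this

/-- Linear extensions of indicators of vertices, and tents on single edges, separate points.
Hausdorffness is what turns an injective path into an embedding. -/
instance : T2Space (Realization G) := by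
  classical
  suffices ∀ x y : Realization G, x ≠ y → ∃ f : Realization G → ℝ, Continuous f ∧ f x ≠ f y from
    ⟨fun x y hxy => by
      obtain ⟨f, hf, hne⟩ := this x y hxy
      exact separated_by_continuous hf hne⟩
  have key : ∀ (v : V) (y : Realization G), vtx v ≠ y →
      ∃ f : Realization G → ℝ, Continuous f ∧ f (vtx v) ≠ f y := by
    intro v y hy
    rcases eq_vtx_or_eq_edgePt y with ⟨w, rfl⟩ | ⟨e, t, h0, h1, rfl⟩
    · obtain ⟨f, hf, hf1, -⟩ := exists_linear_extension (G := G) (fun u => if u = v then 1 else 0)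
      refine ⟨f, hf, ?_⟩
      have hne : w ≠ v := by rintro rfl; exact hy rfl
      simp [hf1, hne]
    · obtain ⟨f, hf, hf1, hf2, -⟩ := exists_tent e
      exact ⟨f, hf, by rw [hf1, hf2]; exact (tent_pos h0 h1).ne⟩
  intro x y hxy
  rcases eq_vtx_or_eq_edgePt x with ⟨v, rfl⟩ | ⟨e, s, hs0, hs1, rfl⟩
  · exact key v y hxy
  rcases eq_vtx_or_eq_edgePt y with ⟨w, rfl⟩ | ⟨e', t, h0, h1, rfl⟩
  · obtain ⟨f, hf, hne⟩ := key w _ hxy.symm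
    exact ⟨f, hf, hne.symm⟩
  by_cases he : e = e'
  · subst he
    obtain ⟨f, hf, -, hf2⟩ :=
      exists_linear_extension (G := G) (fun u => if u = tail e then 1 else 0)
    refine ⟨f, hf, fun h => hxy ?_⟩
    rw [hf2, hf2] at h
    simp only [if_neg (adj_tail_head e).ne.symm, if_true] at h
    exact congrArg _ (Subtype.ext (by linarith))
  · obtain ⟨f, hf, -, hf2, hf3⟩ := exists_tent e'
    exact ⟨f, hf, by rw [hf2, hf3 e s he]; exact (tent_pos h0 h1).ne⟩

/-- The part of an open cell that keeps the distance `δ` from the ends. -/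
def innerCell (δ : ℝ) : V ⊕ G.edgeSet → Set (Realization G)
  | Sum.inl v => {vtx v}
  | Sum.inr e => edgePt e '' {t | δ ≤ t ∧ (t : ℝ) ≤ 1 - δ}

lemma innerCell_subset_openCell {δ : ℝ} (hδ : 0 < δ) (n : V ⊕ G.edgeSet) :
    innerCell δ n ⊆ openCell n := by
  rcases n with v | e
  · exact subset_rfl
  · rintro _ ⟨t, ⟨h1, h2⟩, rfl⟩
    exact ⟨t, ⟨show (0 : ℝ) < t by linarith, show (t : ℝ) < 1 by linarith⟩, rfl⟩

lemma innerCell_anti {δ ε : ℝ} (h : ε ≤ δ) (n : V ⊕ G.edgeSet) :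
    innerCell δ n ⊆ innerCell ε n := by
  rcases n with v | e
  · exact subset_rfl
  · rintro _ ⟨t, ⟨h1, h2⟩, rfl⟩
    exact ⟨t, ⟨by linarith, by linarith⟩, rfl⟩

lemma innerCell_nonempty {δ : ℝ} (hδ' : δ < 1 / 2) (n : V ⊕ G.edgeSet) :
    (innerCell δ n).Nonempty := by
  rcases n with v | e
  · exact ⟨_, rfl⟩
  · exact ⟨_, ⟨1 / 2, by norm_num, by norm_num⟩, ⟨hδ'.le, by show (1 / 2 : ℝ) ≤ 1 - δ; linarith⟩,
      rfl⟩

lemma exists_mem_innerCell (x : Realization G) :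
    ∃ (δ : ℝ) (n : V ⊕ G.edgeSet), 0 < δ ∧ δ < 1 / 2 ∧ x ∈ innerCell δ n := by
  rcases eq_vtx_or_eq_edgePt x with ⟨v, rfl⟩ | ⟨e, t, h0, h1, rfl⟩
  · exact ⟨1 / 4, Sum.inl v, by norm_num, by norm_num, rfl⟩
  · have h0 : (0 : ℝ) < t := h0
    have h1 : (t : ℝ) < 1 := h1
    refine ⟨min (1 / 4) (min t (1 - t)), Sum.inr e, ?_, ?_, t, ⟨?_, ?_⟩, rfl⟩
    · exact lt_min (by norm_num) (lt_min h0 (by linarith))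
    · exact (min_le_left _ _).trans_lt (by norm_num)
    · exact (min_le_right _ _).trans (min_le_left _ _)
    · have : min (1 / 4 : ℝ) (min t (1 - t)) ≤ 1 - t := (min_le_right _ _).trans (min_le_right _ _)
      linarith

lemma exists_arc_edge {e : G.edgeSet} {v w : V} (hv : v ∈ e.1) (hw : w ∈ e.1) (hvw : v ≠ w) :
    ∃ A : Set (Realization G), ArcFromTo A (vtx v) (vtx w) ∧
      A ⊆ insert (vtx v) (insert (vtx w) (openCell (Sum.inr e))) ∧ openCell (Sum.inr e) ⊆ A := by
  have harc : ArcFromTo (edgePt e '' Icc 0 1) (vtx (tail e)) (vtx (head e)) := by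
    rw [← edgePt_zero, ← edgePt_one]
    exact arcFromTo_image_Icc (continuous_edgePt e) (edgePt_injective e) zero_lt_one
  have hsub : edgePt e '' Icc 0 1 ⊆
      insert (vtx (tail e)) (insert (vtx (head e)) (openCell (Sum.inr e))) := by
    rintro _ ⟨t, -, rfl⟩
    rcases eq_or_ne t 0 with rfl | h0
    · exact Or.inl (edgePt_zero e)
    rcases eq_or_ne t 1 with rfl | h1
    · exact Or.inr (Or.inl (edgePt_one e))
    exact Or.inr (Or.inr ⟨t, ⟨unitInterval.pos_iff_ne_zero.2 h0,
      unitInterval.lt_one_iff_ne_one.2 h1⟩, rfl⟩)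
  have hsup : openCell (Sum.inr e) ⊆ edgePt e '' Icc 0 1 := image_mono Ioo_subset_Icc_self
  rcases mem_iff_tail_or_head.1 hv with rfl | rfl <;>
    rcases mem_iff_tail_or_head.1 hw with rfl | rfl
  · exact absurd rfl hvw
  · exact ⟨_, harc, hsub, hsup⟩
  · exact ⟨_, harc.symm, by rw [insert_comm]; exact hsub, hsup⟩
  · exact absurd rfl hvw

/-- Used where a path of the subdivision begins or ends in an edge. Running on to the other end of
`e` might hit the arc again, so the arc stops at distance `δ` before it. -/
lemma exists_arc_part_of_edge {δ : ℝ} (hδ : 0 < δ) (hδ' : δ < 1 / 2) {e : G.edgeSet} {v : V}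
    (hv : v ∈ e.1) :
    ∃ (A : Set (Realization G)) (y : Realization G), ArcFromTo A (vtx v) y ∧
      A ⊆ insert (vtx v) (openCell (Sum.inr e)) ∧ innerCell δ (Sum.inr e) ⊆ A := by
  rcases mem_iff_tail_or_head.1 hv with rfl | rfl
  · set t : unitInterval := ⟨1 - δ, by linarith, by linarith⟩ with ht
    have ht0 : 0 < t := show (0 : ℝ) < 1 - δ by linarith
    have ht1 : t < 1 := show 1 - δ < (1 : ℝ) by linarith
    refine ⟨edgePt e '' Icc 0 t, edgePt e t, ?_, ?_, ?_⟩
    · rw [← edgePt_zero]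
      exact arcFromTo_image_Icc (continuous_edgePt e) (edgePt_injective e) ht0
    · rintro _ ⟨s, ⟨-, hs⟩, rfl⟩
      rcases eq_or_ne s 0 with rfl | h0
      · exact Or.inl (edgePt_zero e)
      · exact Or.inr ⟨s, ⟨unitInterval.pos_iff_ne_zero.2 h0, hs.trans_lt ht1⟩, rfl⟩
    · rintro _ ⟨s, ⟨-, hs⟩, rfl⟩
      exact ⟨s, ⟨s.2.1, hs⟩, rfl⟩
  · set t : unitInterval := ⟨δ, by linarith, by linarith⟩ with ht
    have ht0 : 0 < t := hδ
    have ht1 : t < 1 := show δ < (1 : ℝ) by linarith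
    refine ⟨edgePt e '' Icc t 1, edgePt e t, ?_, ?_, ?_⟩
    · rw [← edgePt_one]
      exact (arcFromTo_image_Icc (continuous_edgePt e) (edgePt_injective e) ht1).symm
    · rintro _ ⟨s, ⟨hs, -⟩, rfl⟩
      rcases eq_or_ne s 1 with rfl | h1
      · exact Or.inl (edgePt_one e)
      · exact Or.inr ⟨s, ⟨ht0.trans_le hs, unitInterval.lt_one_iff_ne_one.2 h1⟩, rfl⟩
    · rintro _ ⟨s, ⟨hs, -⟩, rfl⟩
      exact ⟨s, ⟨hs, s.2.2⟩, rfl⟩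

/-- The union of the open cells in a list. -/
def cellUnion (l : List (V ⊕ G.edgeSet)) : Set (Realization G) := {x | ∃ n ∈ l, x ∈ openCell n}

/-- The two claims feed each other along the path. For a path starting in an edge, `w` is the vertex
from which that edge is entered. The inclusion in the cells of the path ensures that consecutive
pieces meet only in their common end. -/
lemma exists_arc_of_isPath_aux {δ : ℝ} (hδ : 0 < δ) (hδ' : δ < 1 / 2) {n m : V ⊕ G.edgeSet}
    (p : (subdiv G).Walk n m) (hp : p.IsPath) :
    (∀ v, n = Sum.inl v → ∃ (A : Set (Realization G)) (y : Realization G),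
      PointOrArc A (vtx v) y ∧ A ⊆ cellUnion p.support ∧ ∀ k ∈ p.support, innerCell δ k ⊆ A) ∧
    ∀ e w, n = Sum.inr e → w ∈ e.1 → Sum.inl w ∉ p.support →
      ∃ (A : Set (Realization G)) (y : Realization G), ArcFromTo A (vtx w) y ∧
        A ⊆ insert (vtx w) (cellUnion p.support) ∧ ∀ k ∈ p.support, innerCell δ k ⊆ A := by
  induction p with
  | nil =>
    constructor
    · rintro v rfl
      refine ⟨{vtx v}, vtx v, Or.inr ⟨rfl, rfl⟩, ?_, ?_⟩
      · rintro _ rfl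
        exact ⟨Sum.inl v, by simp, rfl⟩
      · intro k hk
        obtain rfl : k = Sum.inl v := by simpa using hk
        exact subset_rfl
    · rintro e w rfl hw -
      obtain ⟨A, y, hA, hsub, hsup⟩ := exists_arc_part_of_edge hδ hδ' hw
      refine ⟨A, y, hA, hsub.trans (insert_subset_insert fun x hx => ⟨Sum.inr e, by simp, hx⟩), ?_⟩
      intro k hk
      obtain rfl : k = Sum.inr e := by simpa using hk
      exact hsup
  | @cons n n' m h p ih =>
    rw [Walk.cons_isPath_iff] at hp
    obtain ⟨ih1, ih2⟩ := ih hp.1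
    constructor
    · rintro v rfl
      rcases n' with v' | e
      · exact absurd h not_subdiv_adj_inl_inl
      obtain ⟨A, y, hA, hsub, hsup⟩ := ih2 e v rfl (subdiv_adj_inl_inr.1 h) hp.2
      have hv : vtx v ∈ A := hA.symm.right_mem
      refine ⟨A, y, Or.inl hA, hsub.trans (insert_subset ?_ ?_), ?_⟩
      · exact ⟨Sum.inl v, by simp, rfl⟩
      · rintro x ⟨k, hk, hx⟩
        exact ⟨k, by simp [hk], hx⟩
      · intro k hk
        rcases (by simpa using hk : k = Sum.inl v ∨ k ∈ p.support) with rfl | hk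
        · exact singleton_subset_iff.2 hv
        · exact hsup k hk
    · rintro e w rfl hw hwp
      rcases n' with v | e'
      swap
      · exact absurd h not_subdiv_adj_inr_inr
      simp only [Walk.support_cons, List.mem_cons, not_or] at hwp
      have hwv : w ≠ v := by
        rintro rfl
        exact hwp.2 p.start_mem_support
      obtain ⟨A, y, hA, hsub, hsup⟩ := ih1 v rfl
      obtain ⟨B, hB, hBsub, hBsup⟩ := exists_arc_edge hw (subdiv_adj_inr_inl.1 h) hwv
      refine ⟨B ∪ A, y, hB.trans_pointOrArc hA ?_, ?_, ?_⟩
      · intro x hxB hxA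
        obtain ⟨k, hk, hxk⟩ := hsub hxA
        rcases hBsub hxB with hx | hx | hx
        · obtain rfl : Sum.inl w = k := eq_of_mem_openCell hx hxk
          exact absurd hk hwp.2
        · exact hx
        · obtain rfl : Sum.inr e = k := eq_of_mem_openCell hx hxk
          exact absurd hk hp.2
      · refine union_subset (hBsub.trans (insert_subset_insert (insert_subset ?_ ?_))) ?_
        · exact ⟨Sum.inl v, by simp, rfl⟩
        · exact fun x hx => ⟨Sum.inr e, by simp, hx⟩
        · intro x hx
          obtain ⟨k, hk, hxk⟩ := hsub hx
          exact Or.inr ⟨k, by simp [hk], hxk⟩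
      · intro k hk
        rcases (by simpa using hk : k = Sum.inr e ∨ k ∈ p.support) with rfl | hk
        · exact ((innerCell_subset_openCell hδ _).trans hBsup).trans subset_union_left
        · exact (hsup k hk).trans subset_union_right

/-- A path of the subdivision with at least two vertices gives rise to an arc. -/
lemma exists_isArc_of_isPath {δ : ℝ} (hδ : 0 < δ) (hδ' : δ < 1 / 2) {n m : V ⊕ G.edgeSet}
    (p : (subdiv G).Walk n m) (hp : p.IsPath) {k k' : V ⊕ G.edgeSet} (hk : k ∈ p.support)
    (hk' : k' ∈ p.support) (hne : k ≠ k') :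
    ∃ A : Set (Realization G), IsArc A ∧ ∀ k ∈ p.support, innerCell δ k ⊆ A := by
  rcases n with v | e
  · obtain ⟨A, y, hA, -, hsup⟩ := (exists_arc_of_isPath_aux hδ hδ' p hp).1 v rfl
    refine ⟨A, ?_, hsup⟩
    rcases hA with hA | ⟨rfl, -⟩
    · exact hA.isArc
    -- A single point cannot contain the inner cells of two different nodes.
    · have hcell : ∀ k ∈ p.support, k = Sum.inl v := by
        intro k hk
        obtain ⟨x, hx⟩ := innerCell_nonempty hδ' k
        exact eq_of_mem_openCell (innerCell_subset_openCell hδ k hx) (hsup k hk hx)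
      exact absurd ((hcell k hk).trans (hcell k' hk').symm) hne
  · cases p with
    | nil =>
      simp only [Walk.support_nil, List.mem_singleton] at hk hk'
      exact absurd (hk.trans hk'.symm) hne
    | @cons _ n' _ h p =>
      rcases n' with v | e'
      swap
      · exact absurd h not_subdiv_adj_inr_inr
      rw [Walk.cons_isPath_iff] at hp
      obtain ⟨A, y, hA, hsub, hsup⟩ := (exists_arc_of_isPath_aux hδ hδ' p hp.1).1 v rfl
      obtain ⟨B, z, hB, hBsub, hBsup⟩ := exists_arc_part_of_edge hδ hδ' (subdiv_adj_inr_inl.1 h)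
      refine ⟨B ∪ A, (hB.symm.trans_pointOrArc hA ?_).isArc, ?_⟩
      · intro x hxB hxA
        obtain ⟨k, hk, hxk⟩ := hsub hxA
        rcases hBsub hxB with hx | hx
        · exact hx
        · obtain rfl : Sum.inr e = k := eq_of_mem_openCell hx hxk
          exact absurd hk hp.2
      · intro k hk
        rcases (by simpa using hk : k = Sum.inr e ∨ k ∈ p.support) with rfl | hk
        · exact hBsup.trans subset_union_left
        · exact (hsup k hk).trans subset_union_right

end Realization

end ArcGraph

namespace ArcGraph

open SimpleGraph Set

/-! ### Separating vertices obstruct arcs -/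

section Separation

variable {V : Type u} {G : SimpleGraph V}

lemma linear_combination_eq_zero {a b t : ℝ} (h0 : 0 < t) (h1 : t < 1)
    (h : (1 - t) * a + t * b = 0) (hab : a = b ∨ (a = 0 ∧ b ≠ 0) ∨ (b = 0 ∧ a ≠ 0)) :
    a = 0 ∧ b = 0 := by
  rcases hab with rfl | ⟨rfl, hb⟩ | ⟨rfl, ha⟩
  · have : a = 0 := by linarith
    exact ⟨this, this⟩
  · rw [mul_zero, zero_add] at h
    exact absurd ((mul_eq_zero.1 h).resolve_left h0.ne') hb
  · rw [mul_zero, add_zero] at h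
    exact absurd ((mul_eq_zero.1 h).resolve_left (sub_pos.2 h1).ne') ha

/-- If `c` separates vertices, then some continuous function on the realization that vanishes
only in `c` has different signs in them. -/
lemma exists_separating_function {v c : V} (hvc : v ≠ c) :
    ∃ f : Realization G → ℝ, Continuous f ∧ (∀ x, f x = 0 → x = vtx c) ∧ f (vtx v) = 1 ∧
      ∀ w, w ≠ c → ¬ (del G c).Reachable v w → f (vtx w) = -1 := by
  classical
  -- Adjacent vertices other than `c` get the same sign, so linear interpolation produces no zero
  -- inside an edge.
  set φ : V → ℝ := fun w => if w = c then 0 else if (del G c).Reachable v w then 1 else -1 with hφ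
  have hc : φ c = 0 := if_pos rfl
  have h0 : ∀ w, φ w = 0 → w = c := by
    intro w hw
    by_contra hwc
    by_cases h : (del G c).Reachable v w <;> simp [hφ, hwc, h] at hw
  have hadj : ∀ a b, G.Adj a b → a ≠ c → b ≠ c → φ a = φ b := by
    intro a b hab ha hb
    have hab' : (del G c).Adj a b := ⟨hab, ha, hb⟩
    have : (del G c).Reachable v a ↔ (del G c).Reachable v b :=
      ⟨fun h => h.trans hab'.reachable, fun h => h.trans hab'.symm.reachable⟩
    simp [hφ, ha, hb, this]
  obtain ⟨f, hf, hf1, hf2⟩ := exists_linear_extension (G := G) φ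
  refine ⟨f, hf, ?_, ?_, ?_⟩
  · intro x hx
    rcases eq_vtx_or_eq_edgePt x with ⟨w, rfl⟩ | ⟨e, t, ht0, ht1, rfl⟩
    · rw [h0 w (by rw [← hf1, hx])]
    · exfalso
      rw [hf2] at hx
      have hth := adj_tail_head e
      have := linear_combination_eq_zero ht0 ht1 hx (by
        by_cases ha : tail e = c
        · refine Or.inr (Or.inl ⟨by rw [ha, hc], fun hb => ?_⟩)
          exact hth.ne (ha.trans (h0 _ hb).symm)
        by_cases hb : head e = c
        · exact Or.inr (Or.inr ⟨by rw [hb, hc], fun ha' => ha (h0 _ ha')⟩)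
        · exact Or.inl (hadj _ _ hth ha hb))
      exact hth.ne ((h0 _ this.1).trans (h0 _ this.2).symm)
  · rw [hf1]
    simp [hφ, hvc]
  · intro w hw hvw
    rw [hf1]
    simp [hφ, hw, hvw]

/-- The indicator of a component extends to a continuous function with values 0 and 1 only; on an
arc joining two components it would take the value 1/2. -/
lemma connected_of_isAc [Nonempty V] (h : IsAc 3 G) : G.Connected := by
  classical
  refine ⟨fun v w => ?_⟩
  by_contra hvw
  obtain ⟨A, ⟨η⟩, hA⟩ := h {vtx v, vtx w} ((encard_insert_le _ _).trans (by
    rw [encard_singleton]; norm_num))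
  set φ : V → ℝ := fun u => if G.Reachable v u then 1 else 0 with hφ
  obtain ⟨f, hf, hf1, hf2⟩ := exists_linear_extension (G := G) φ
  have hval : ∀ x, f x = 0 ∨ f x = 1 := by
    have hφ' : ∀ u, φ u = 0 ∨ φ u = 1 := fun u => by
      by_cases h : G.Reachable v u <;> simp [hφ, h]
    intro x
    rcases eq_vtx_or_eq_edgePt x with ⟨u, rfl⟩ | ⟨e, t, -, -, rfl⟩
    · rw [hf1]; exact hφ' u
    · have hth := adj_tail_head e
      have : G.Reachable v (tail e) ↔ G.Reachable v (head e) :=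
        ⟨fun h => h.trans hth.reachable, fun h => h.trans hth.symm.reachable⟩
      have heq : φ (tail e) = φ (head e) := by simp [hφ, this]
      rw [hf2, heq, ← add_mul, sub_add_cancel, one_mul]
      exact hφ' _
  have hcont : Continuous fun t : unitInterval => f (η.symm t) :=
    hf.comp (continuous_subtype_val.comp η.symm.continuous)
  have hv : f (η.symm (η ⟨vtx v, hA (by simp)⟩)) = 1 := by simp [hf1, hφ]
  have hw : f (η.symm (η ⟨vtx w, hA (by simp)⟩)) = 0 := by simp [hf1, hφ, hvw]
  obtain ⟨t, ht⟩ := mem_range_of_exists_le_of_exists_ge hcont (c := 1 / 2)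
    ⟨_, hw.trans_le (by norm_num)⟩ ⟨_, le_of_le_of_eq (by norm_num) hv.symm⟩
  rcases hval (η.symm t) with h | h
  · simp only [h] at ht; norm_num at ht
  · simp only [h] at ht; norm_num at ht

/-- Along the arc some `v j` lies between the other two. The function separating `v j` by `c j` has
values -1, 1, -1 there, so it vanishes before and after `v j`. Both zeros are the point `c j`, so
their parameters agree and equal that of `v j`, where the function is 1. -/
lemma not_hasSeparatedTriple_of_isAc (h : IsAc 3 G) : ¬ HasSeparatedTriple G := by
  rintro ⟨v, c, hvc, hsep⟩
  obtain ⟨A, ⟨η⟩, hA⟩ := h {vtx (v 0), vtx (v 1), vtx (v 2)} (by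
    refine (encard_insert_le _ _).trans ?_
    refine (add_le_add_left (encard_insert_le _ _) _).trans ?_
    rw [encard_singleton]; norm_num)
  have hvA : ∀ i, vtx (v i) ∈ A := by
    intro i
    fin_cases i
    · exact hA (by simp)
    · exact hA (by simp)
    · exact hA (by simp)
  set τ : Fin 3 → unitInterval := fun i => η ⟨vtx (v i), hvA i⟩ with hτ
  have hητ : ∀ i, (η.symm (τ i) : Realization G) = vtx (v i) := fun i => by simp [hτ]
  have hne : ∀ i j, i ≠ j → τ i ≠ τ j := by
    intro i j hij heq
    have h1 := hητ i
    rw [heq, hητ j] at h1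
    exact hsep i j hij (vtx_injective h1 ▸ Reachable.refl _)
  have key : ∀ i j k, i ≠ j → k ≠ j → τ i ≤ τ j → τ j ≤ τ k → False := by
    intro i j k hij hkj h1 h2
    obtain ⟨f, hf, hf0, hfv, hfw⟩ := exists_separating_function (G := G) (hvc j j)
    have hcont : Continuous fun t : unitInterval => f (η.symm t) :=
      hf.comp (continuous_subtype_val.comp η.symm.continuous)
    have hi : f (η.symm (τ i)) = -1 := by rw [hητ]; exact hfw _ (hvc j i) (hsep j i hij.symm)
    have hj : f (η.symm (τ j)) = 1 := by rw [hητ]; exact hfv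
    have hk : f (η.symm (τ k)) = -1 := by rw [hητ]; exact hfw _ (hvc j k) (hsep j k hkj.symm)
    obtain ⟨s, hs, hs0⟩ := intermediate_value_Icc h1 hcont.continuousOn
      (show (0 : ℝ) ∈ Icc _ _ by simp only [hi, hj]; norm_num)
    obtain ⟨t, ht, ht0⟩ := intermediate_value_Icc' h2 hcont.continuousOn
      (show (0 : ℝ) ∈ Icc _ _ by simp only [hk, hj]; norm_num)
    have hst : s = t := η.symm.injective (Subtype.ext ((hf0 _ hs0).trans (hf0 _ ht0).symm))
    subst hst
    have : s = τ j := le_antisymm hs.2 ht.1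
    subst this
    simp only [hj] at hs0
    norm_num at hs0
  rcases le_total (τ 0) (τ 1) with h01 | h01 <;> rcases le_total (τ 1) (τ 2) with h12 | h12 <;>
    rcases le_total (τ 0) (τ 2) with h02 | h02
  · exact key 0 1 2 (by decide) (by decide) h01 h12
  · exact key 0 1 2 (by decide) (by decide) h01 h12
  · exact key 0 2 1 (by decide) (by decide) h02 h12
  · exact key 2 0 1 (by decide) (by decide) h02 h01
  · exact key 1 0 2 (by decide) (by decide) h01 h02
  · exact key 1 2 0 (by decide) (by decide) h12 h02
  · exact key 2 1 0 (by decide) (by decide) h12 h01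
  · exact key 2 1 0 (by decide) (by decide) h12 h01

end Separation

/-! ### Chain graphs are 3-ac -/

section ChainArcs

variable {V : Type u} {G : SimpleGraph V}

lemma exists_subset_triple {X : Type*} [Nonempty X] {S : Set X} (hS : S.encard ≤ (3 : ℕ)) :
    ∃ p : Fin 3 → X, ∀ x ∈ S, ∃ i, p i = x := by
  have hfin : S.Finite := finite_of_encard_le_coe hS
  rcases S.eq_empty_or_nonempty with rfl | ⟨x₀, hx₀⟩
  · exact ⟨fun _ => Classical.arbitrary X, by simp⟩
  · have := hfin.fintype
    have hcard : Fintype.card S ≤ Fintype.card (Fin 3) := by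
      rw [← Set.toFinset_card, Fintype.card_fin]
      rw [Set.encard_eq_coe_toFinset_card] at hS
      exact_mod_cast hS
    obtain ⟨g⟩ := Function.Embedding.nonempty_of_card_le hcard
    have : Nonempty S := ⟨⟨x₀, hx₀⟩⟩
    exact ⟨fun i => (Function.invFun g i : S), fun x hx => ⟨g ⟨x, hx⟩,
      congrArg Subtype.val (Function.leftInverse_invFun g.injective ⟨x, hx⟩)⟩⟩

lemma exists_isPath_pair (hG : G.Connected) {n m : V ⊕ G.edgeSet} :
    ∃ (a b : V ⊕ G.edgeSet) (p : (subdiv G).Walk a b), p.IsPath ∧ n ∈ p.support ∧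
      m ∈ p.support := by
  obtain ⟨p, hp⟩ := ((subdiv_connected hG).preconnected n m).exists_isPath
  exact ⟨n, m, p, hp, p.start_mem_support, p.end_mem_support⟩

/-- A chain graph with `2`-connected links and at least two vertices is `3`-ac. -/
lemma isAc_of_isChainGraph [Nontrivial V] (h : IsChainGraphOfTwoConnected G) : IsAc 3 G := by
  obtain ⟨hG, ι, _, L, hL, h2⟩ := h
  intro S hS
  have : Nontrivial (V ⊕ G.edgeSet) := Sum.inl_injective.nontrivial
  have : Nonempty (Realization G) := ⟨vtx (Classical.arbitrary V)⟩
  obtain ⟨x, hx⟩ := exists_subset_triple hS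
  choose δ n hδ hδ' hxn using fun i => exists_mem_innerCell (x i)
  -- The three cells may coincide. If all do, a further node `m` is added, since a path with a
  -- single node need not give an arc.
  obtain ⟨a, b, p, hp, hnp, k, hk, k', hk', hne⟩ : ∃ (a b : V ⊕ G.edgeSet)
      (p : (subdiv G).Walk a b), p.IsPath ∧ (∀ i, n i ∈ p.support) ∧
        ∃ k ∈ p.support, ∃ k' ∈ p.support, k ≠ k' := by
    by_cases h01 : n 0 = n 1
    · by_cases h02 : n 0 = n 2
      · obtain ⟨m, hm⟩ := exists_ne (n 0)
        obtain ⟨a, b, p, hp, h1, h2⟩ := exists_isPath_pair hG (n := n 0) (m := m)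
        exact ⟨a, b, p, hp, Fin.forall_fin_succ.2 ⟨h1, Fin.forall_fin_two.2
          ⟨h01 ▸ h1, h02 ▸ h1⟩⟩, _, h2, _, h1, hm⟩
      · obtain ⟨a, b, p, hp, h1, h2⟩ := exists_isPath_pair hG (n := n 0) (m := n 2)
        exact ⟨a, b, p, hp, Fin.forall_fin_succ.2 ⟨h1, Fin.forall_fin_two.2
          ⟨h01 ▸ h1, h2⟩⟩, _, h1, _, h2, h02⟩
    by_cases h02 : n 0 = n 2
    · obtain ⟨a, b, p, hp, h1, h2⟩ := exists_isPath_pair hG (n := n 0) (m := n 1)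
      exact ⟨a, b, p, hp, Fin.forall_fin_succ.2 ⟨h1, Fin.forall_fin_two.2
        ⟨h2, h02 ▸ h1⟩⟩, _, h1, _, h2, h01⟩
    by_cases h12 : n 1 = n 2
    · obtain ⟨a, b, p, hp, h1, h2⟩ := exists_isPath_pair hG (n := n 0) (m := n 1)
      exact ⟨a, b, p, hp, Fin.forall_fin_succ.2 ⟨h1, Fin.forall_fin_two.2
        ⟨h2, h12 ▸ h2⟩⟩, _, h1, _, h2, h01⟩
    obtain ⟨a, b, p, hp, h1, h2, h3⟩ := hL.exists_isPath hG h2 h01 h02 h12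
    exact ⟨a, b, p, hp, Fin.forall_fin_succ.2 ⟨h1, Fin.forall_fin_two.2 ⟨h2, h3⟩⟩, _, h1, _, h2,
      h01⟩
  -- Inner cells grow as `δ` shrinks, so the smallest `δ` serves all three points.
  obtain ⟨i₀, hi₀⟩ := Finite.exists_min δ
  obtain ⟨A, hA, hcell⟩ := exists_isArc_of_isPath (hδ i₀) (hδ' i₀) p hp hk hk' hne
  refine ⟨A, hA, fun y hy => ?_⟩
  obtain ⟨i, rfl⟩ := hx y hy
  exact hcell _ (hnp i) (innerCell_anti (hi₀ i) _ (hxn i))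

end ChainArcs

end ArcGraph

theorem mainTheorem7 {V : Type u} [Nontrivial V] (G : SimpleGraph V) :
    (ArcGraph.IsAc 3 G ↔ ArcGraph.IsChainGraphOfTwoConnected G) ∧
    (ArcGraph.IsAc 3 G ↔
      ArcGraph.IsFinitePath (ArcGraph.blockGraph G) ∨ ArcGraph.IsRay (ArcGraph.blockGraph G) ∨
        ArcGraph.IsDoubleRay (ArcGraph.blockGraph G)) ∧
    (ArcGraph.IsAc 3 G ↔
      (ArcGraph.blockGraph G).Connected ∧
        ∀ p, ¬ 3 ≤ ((ArcGraph.blockGraph G).neighborSet p).encard) := by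
  have h14 : ArcGraph.IsAc 3 G → (ArcGraph.blockGraph G).Connected ∧
      ∀ p, ¬ 3 ≤ ((ArcGraph.blockGraph G).neighborSet p).encard := fun h =>
    have hG := ArcGraph.connected_of_isAc h
    ⟨ArcGraph.blockGraph_connected hG, fun p hp => ArcGraph.not_hasSeparatedTriple_of_isAc h
      (ArcGraph.hasSeparatedTriple_of_degree hG p hp)⟩
  have h4 : (ArcGraph.blockGraph G).Connected ∧
      (∀ p, ¬ 3 ≤ ((ArcGraph.blockGraph G).neighborSet p).encard) →
        ArcGraph.IsLinear (ArcGraph.blockGraph G) := fun h =>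
    ArcGraph.isLinear_of_isTree ⟨h.1, ArcGraph.blockGraph_isAcyclic⟩ h.2
  have h21 : ArcGraph.IsChainGraphOfTwoConnected G → ArcGraph.IsAc 3 G :=
    ArcGraph.isAc_of_isChainGraph
  have hlin : ArcGraph.IsLinear (ArcGraph.blockGraph G) → ArcGraph.IsChainGraphOfTwoConnected G :=
    ArcGraph.isChainGraph_of_isLinear
  exact ⟨⟨fun h => hlin (h4 (h14 h)), h21⟩,
    ⟨fun h => ArcGraph.isFinitePath_or_of_isLinear (h4 (h14 h)),
      fun h => h21 (hlin (ArcGraph.isLinear_of_isFinitePath_or h))⟩,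
    ⟨h14, fun h => h21 (hlin (h4 h))⟩⟩
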